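/- **Setting.** Let $H>0$, $0<L_0<L$, $\Omega=(0,L)\times(-H,H)$, and for $l\in(0,L]$ let $K_l=[0,l]\times\{0\}$ be the crack. Let $\lambda\in(0,1)$ and let $\boldsymbol C_A=\mathrm{diag}(\mu_{A,1},\mu_{A,2})$, $\boldsymbol C_B=\mathrm{diag}(\mu_{B,1},\mu_{B,2})$ with positive entries, and $G^c_A,G^c_B>0$. For $n\ge1$, $\boldsymbol C_n$ and $G^c_n$ are the stiffness and the toughness which equal $\boldsymbol C_A,G^c_A$ for $x_1\in(\tfrac{kL}{n},\tfrac{(k+\lambda)L}{n})$ and $\boldsymbol C_B,G^c_B$ for $x_1\in(\tfrac{(k+\lambda)L}{n},\tfrac{(k+1)L}{n})$, $k=0,\dots,n-1$; $G^c_n$ is extended to $[0,L)$ by right continuity and $G^c_n(L)=G^c_A$. Let $\Lambda_n$ be the finite set of all points $\tfrac{kL}{n}$ ($0\le k\le n$) and $\tfrac{(k+\lambda)L}{n}$ ($0\le k<n$). Let $\partial_D\Omega=\{0\}\times((-H,0)\cup(0,H))\,\cup\,\{L\}\times(-H,H)$ and $g\in H^{1/2}(\partial_D\Omega)$, i.e.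 $g\in L^2(\partial_D\Omega)$ is the trace of a function in $H^1(\Omega\setminus K_l)$ for some $l\in(0,L)$. The condensed elastic energy for the datum $g$ is $$\mathcal E_n(l)=\min\Big\{\tfrac12\int_{\Omega\setminus K_l}\nabla u\,\boldsymbol C_n\nabla u^T\,dx\;:\;u\in H^1(\Omega\setminus K_l),\ u=g\text{ on }\partial_D\Omega\Big\},$$ and the energy release $\mathcal G_n$, with values in $[0,+\infty]$, is $\mathcal G_n(l)=-\mathcal E_n'(l)$ for $l\in(0,L)\setminus\Lambda_n$, $\mathcal G_n(l)=\liminf_{s\to l^+}\mathcal G_n(s)$ for $l\in\Lambda_n\setminus\{L\}$, and $\mathcal G_n(L)=0$. Let $T>0$ and $f\in C^1([0,T])$ with $f(0)=0$ and $f'>0$. Denote by $G_n(t,\cdot)$ the energy release for the datum $f(t)g$ (so $G_n(t,l)=f^2(t)\,\mathcal G_n(l)$ for $t>0$, and $G_n(0,\cdot)=0$). For $n\ge1$ let $\ell_n:[0,T)\to[L_0,L]$ be the quasi-static evolution, i.e. the (unique) non-decreasing, right continuous function with $\ell_n(0)=L_0$ which satisfies Griffith's criterion: for every $t\in[0,T)$,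 - i) $G_n(t,\ell_n(t))\le G^c_n(\ell_n(t))$; - ii) if $G_n(t,\ell_n(t))<G^c_n(\ell_n(t))$ then $\ell_n$ is right differentiable at $t$ with right derivative $0$; - iii) if $t$ is a discontinuity point of $\ell_n$ then $G_n(t,l)\ge G^c_n(l)$ for every $l\in[\ell_n^-(t),\ell_n(t))$, where $\ell_n^-(t)$ is the left limit. **Proposition 1.9.** There is a subsequence $(\ell_{n_k})_k$ which converges pointwise in $[0,T)$. Moreover, whenever a subsequence $(\ell_{n_k})_k$ converges pointwise in $[0,T)$ to a function $\ell$, the right continuous representative $\ell^+(t)=\lim_{\tau\to t^+}\ell(\tau)$ of $\ell$ is given, for every $t\in[0,T)$, by $$\ell^+(t)=\inf\Big\{l\in[L_0,L]\;:\;\Gamma\text{-}\liminf_{k\to\infty}\frac{\mathcal G_{n_k}}{G^c_{n_k}}(l)<\frac1{f^2(t)}\Big\},\qquad \frac1{f^2(0)}=+\infty,$$ where, for $l\in[L_0,L]$, $$\Gamma\text{-}\liminf_{k\to\infty}\frac{\mathcal G_{n_k}}{G^c_{n_k}}(l)=\inf\Big\{\liminf_{k\to\infty}\frac{\mathcal G_{n_k}(l_k)}{G^c_{n_k}(l_k)}\;:\;l_k\in[L_0,L],\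 l_k\to l\Big\}.$$ -/

import Mathlib

open Set Filter Topology MeasureTheory
open scoped ENNReal ContDiff

noncomputable section

/-- Geometric and material data of a brittle laminate in the anti-plane setting: the uncracked
body is `(0,L) × (-H,H)`, `L₀` is the length of the initial crack, `lam` is the volume fraction of
material `A`; the stiffness matrices are `diag(μA₁, μA₂)` and `diag(μB₁, μB₂)`, the toughnesses
are `gcA` and `gcB`. -/
structure Laminate where
  L : ℝ
  H : ℝ
  L₀ : ℝ
  lam : ℝ
  μA₁ : ℝ
  μA₂ : ℝ
  μB₁ : ℝ
  μB₂ : ℝ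
  gcA : ℝ
  gcB : ℝ
  H_pos : 0 < H
  L₀_pos : 0 < L₀
  L₀_lt : L₀ < L
  lam_pos : 0 < lam
  lam_lt : lam < 1
  μA₁_pos : 0 < μA₁
  μA₂_pos : 0 < μA₂
  μB₁_pos : 0 < μB₁
  μB₂_pos : 0 < μB₂
  gcA_pos : 0 < gcA
  gcB_pos : 0 < gcB

namespace Laminate

variable (D : Laminate)

/-- The uncracked body `Ω = (0,L) × (-H,H)`. -/
def body : Set (ℝ × ℝ) := Ioo 0 D.L ×ˢ Ioo (-D.H) D.H

/-- The crack `K_l = [0,l] × {0}`. -/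
def crack (l : ℝ) : Set (ℝ × ℝ) := Icc 0 l ×ˢ {0}

/-- The cracked body `Ω ∖ K_l`. -/
def cracked (l : ℝ) : Set (ℝ × ℝ) := D.body \ crack l

open Classical in
/-- The `n`-periodic coefficient equal to `a` in material `A` and to `b` in material `B`, as a
function of the horizontal coordinate `x`. The period is `L/n`; with `l_{n,k} = k L / n`, the value
is `a` on `[l_{n,k}, l_{n,k} + lam L / n)` and `b` on `[l_{n,k} + lam L / n, l_{n,k+1})`. Thus it is
right continuous, and its value at `x = L` is `a`. -/
def layered (a b : ℝ) (n : ℕ) (x : ℝ) : ℝ :=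
  if Int.fract (n * x / D.L) < D.lam then a else b

/-- The set `Λ_n ⊆ [0,L]` of the abscissae of the interfaces (and of the two lateral sides). -/
def interfaces (n : ℕ) : Set ℝ :=
  {l | (∃ k : ℕ, k ≤ n ∧ l = k * (D.L / n)) ∨ ∃ k : ℕ, k < n ∧ l = (k + D.lam) * (D.L / n)}

/-- The toughness `G^c_n`, extended to the interfaces by right continuity and to `L` by `gcA`. -/
def toughness (n : ℕ) (l : ℝ) : ℝ := D.layered D.gcA D.gcB n l

end Laminate

/-- `p = (p.1, p.2)` is the weak gradient of `u` in the open set `U` of the plane. -/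
def HasWeakGradient (U : Set (ℝ × ℝ)) (u : ℝ × ℝ → ℝ) (p : ℝ × ℝ → ℝ × ℝ) : Prop :=
  ∀ φ : ℝ × ℝ → ℝ, ContDiff ℝ ∞ φ → HasCompactSupport φ → tsupport φ ⊆ U →
    (∫ x in U, u x * fderiv ℝ φ x (1, 0) = - ∫ x in U, (p x).1 * φ x) ∧
    (∫ x in U, u x * fderiv ℝ φ x (0, 1) = - ∫ x in U, (p x).2 * φ x)

/-- `u ∈ H¹(U)` with weak gradient `p`. -/
structure IsSobolev (U : Set (ℝ × ℝ)) (u : ℝ × ℝ → ℝ) (p : ℝ × ℝ → ℝ × ℝ) : Prop where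
  memLp : MemLp u 2 (volume.restrict U)
  memLp_fst : MemLp (fun x => (p x).1) 2 (volume.restrict U)
  memLp_snd : MemLp (fun x => (p x).2) 2 (volume.restrict U)
  hasWeakGradient : HasWeakGradient U u p

namespace Laminate

variable (D : Laminate)

/-- The function `u` on `Ω ∖ K_l`, with weak gradient `p`, has trace `g` on the Dirichlet boundary,
i.e. on the vertical sides `{0} × ((-H,0) ∪ (0,H))` and `{L} × (-H,H)` of the body. The trace is
expressed by Green's formula for the horizontal derivative, tested with smooth functions that vanish
near the crack and near the horizontal sides of the body, but not on the vertical sides. -/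
def HasTrace (l : ℝ) (u : ℝ × ℝ → ℝ) (p : ℝ × ℝ → ℝ × ℝ) (g : ℝ × ℝ → ℝ) : Prop :=
  ∀ φ : ℝ × ℝ → ℝ, ContDiff ℝ ∞ φ → HasCompactSupport φ →
    tsupport φ ⊆ (univ ×ˢ Ioo (-D.H) D.H) \ crack l →
    ∫ x in D.cracked l, u x * fderiv ℝ φ x (1, 0) =
      - (∫ x in D.cracked l, (p x).1 * φ x)
      + (∫ y in Ioo (-D.H) D.H, g (D.L, y) * φ (D.L, y))
      - ∫ y in Ioo (-D.H) D.H, g (0, y) * φ (0, y)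

/-- `u`, with weak gradient `p`, is an admissible displacement for the crack `K_l` and the boundary
datum `g`: `u ∈ H¹(Ω ∖ K_l)` and `u = g` on the Dirichlet boundary. -/
def IsAdmissible (g : ℝ × ℝ → ℝ) (l : ℝ) (u : ℝ × ℝ → ℝ) (p : ℝ × ℝ → ℝ × ℝ) : Prop :=
  IsSobolev (D.cracked l) u p ∧ D.HasTrace l u p g

/-- `g ∈ H^{1/2}` of the Dirichlet boundary, the disjoint union of the three segments
`{0} × (-H,0)`, `{0} × (0,H)` and `{L} × (-H,H)`: `g` is square integrable there, and it is the trace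
of an `H¹` function on `Ω ∖ K_l` for some `l ∈ (0,L)`. (By a cut-off in the first variable, the trace
space does not depend on the choice of `l ∈ (0,L)`.) -/
def MemHHalf (g : ℝ × ℝ → ℝ) : Prop :=
  MemLp (fun y => g (0, y)) 2 (volume.restrict (Ioo (-D.H) D.H)) ∧
  MemLp (fun y => g (D.L, y)) 2 (volume.restrict (Ioo (-D.H) D.H)) ∧
  ∃ l ∈ Ioo 0 D.L, ∃ u p, D.IsAdmissible g l u p

/-- The linear elastic energy `½ ∫_{Ω ∖ K_l} ∇u C_n ∇uᵀ` of a displacement with gradient `p`. -/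
def elasticEnergy (n : ℕ) (l : ℝ) (p : ℝ × ℝ → ℝ × ℝ) : ℝ :=
  1 / 2 * ∫ x in D.cracked l,
    (D.layered D.μA₁ D.μB₁ n x.1 * (p x).1 ^ 2 + D.layered D.μA₂ D.μB₂ n x.1 * (p x).2 ^ 2)

/-- The condensed elastic energy for the boundary datum `g`: the minimum of the elastic energy among
the displacements that are admissible for the crack `K_l`. -/
def condensedEnergy (g : ℝ × ℝ → ℝ) (n : ℕ) (l : ℝ) : ℝ :=
  sInf {e | ∃ u p, D.IsAdmissible g l u p ∧ e = D.elasticEnergy n l p}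

open Classical in
/-- The energy release for the boundary datum `g`, with values in `[0,∞]`: minus the derivative of
the (non-increasing) condensed energy off the interfaces, the lower limit from the right of these
values at the interfaces `l ≠ L`, and `0` at `L`. -/
def energyRelease (g : ℝ × ℝ → ℝ) (n : ℕ) (l : ℝ) : ℝ≥0∞ :=
  if l = D.L then 0
  else if l ∈ D.interfaces n then
    liminf (fun s => ENNReal.ofReal (- deriv (D.condensedEnergy g n) s)) (𝓝[>] l)
  else ENNReal.ofReal (- deriv (D.condensedEnergy g n) l)

/-- `ℓ : [0,T) → [L₀,L]` is the quasi-static evolution, for the time dependent boundary datum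
`f(t) g`, in the laminate with `n` periods: it is non-decreasing, right continuous, `ℓ(0) = L₀` and
it satisfies Griffith's criterion. (Values of `ℓ` outside `[0,T)` are irrelevant.) -/
structure IsQuasiStaticEvolution (T : ℝ) (f : ℝ → ℝ) (g : ℝ × ℝ → ℝ) (n : ℕ) (ℓ : ℝ → ℝ) :
    Prop where
  mapsTo : MapsTo ℓ (Ico 0 T) (Icc D.L₀ D.L)
  monotoneOn : MonotoneOn ℓ (Ico 0 T)
  right_continuous : ∀ t ∈ Ico 0 T, ContinuousWithinAt ℓ (Ici t) t
  initial : ℓ 0 = D.L₀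
  stable : ∀ t ∈ Ico 0 T,
    D.energyRelease (f t • g) n (ℓ t) ≤ ENNReal.ofReal (D.toughness n (ℓ t))
  stationary : ∀ t ∈ Ico 0 T,
    D.energyRelease (f t • g) n (ℓ t) < ENNReal.ofReal (D.toughness n (ℓ t)) →
      HasDerivWithinAt ℓ 0 (Ici t) t
  unstable_jump : ∀ t ∈ Ico 0 T, ¬ ContinuousWithinAt ℓ (Ico 0 T) t →
    ∀ ℓm : ℝ, Tendsto ℓ (𝓝[<] t) (𝓝 ℓm) → ∀ l ∈ Ico ℓm (ℓ t),
      ENNReal.ofReal (D.toughness n l) ≤ D.energyRelease (f t • g) n l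

/-- The ratio `𝒢_n / G^c_n` of the energy release for the boundary datum `g` to the toughness. -/
def releaseRatio (g : ℝ × ℝ → ℝ) (n : ℕ) (l : ℝ) : ℝ≥0∞ :=
  D.energyRelease g n l / ENNReal.ofReal (D.toughness n l)

end Laminate

/-- The (sequential) `Γ`-lower limit at `x`, in the metric space `S ⊆ ℝ`, of the functions `F k`:
the infimum of `liminf_k F k (y k)` over all sequences `y` in `S` that converge to `x`. -/
def gammaLiminf (S : Set ℝ) (F : ℕ → ℝ → ℝ≥0∞) (x : ℝ) : ℝ≥0∞ :=
  ⨅ (y : ℕ → ℝ) (_ : ∀ k, y k ∈ S) (_ : Tendsto y atTop (𝓝 x)),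
    liminf (fun k => F k (y k)) atTop

end

/-! Write r_n for the ratio 𝒢_n / G^c_n. Two facts tie ℓ_n to r_n. Stability gives r_n(ℓ_n(t)) ≤
1/f²(t) (`releaseRatio_le`). Conversely, a length l with r_n(l) < 1/f²(t) is a barrier: ℓ_n(t) ≤ l
(`le_of_releaseRatio_lt`). Both pass to the limit. For τ > t the limit ℓ(τ) lies in the set of the
formula at t, because the ℓ_{n_k}(τ) are themselves a competitor for the Γ-liminf and f is strictly
increasing. If l is in that set, some l_k → l are barriers infinitely often, up to times τ slightly
larger than t, so ℓ(τ) ≤ l. Hence ℓ(τ) is squeezed onto the infimum as τ → t⁺. The convergent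
subsequence comes from Helly's theorem.

The barrier property needs release < toughness on a whole strip [l, l+ε): Griffith's criterion then
forbids jumps there and freezes the tip by its zero right derivative (`le_of_release_lt`). Off the
interfaces the strip comes from upper semicontinuity of 𝒢_n; at an interface, the lower limit from
the right in the definition supplies good points just to the right.

Semicontinuity is an inner variation argument. A smooth stretch of x₁ inside one layer moves the tip
from y to y + h and turns the condensed energy into an infimum of weighted energies over a fixed set
of gradients (`condensedEnergy_stretch`). These expand to first order in h with a uniform quadratic
remainder, and the parallelogram identity makes the first order terms of almost minimizers agree. So
the condensed energy is differentiable and lies below uniform tangent parabolas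
(`exists_hasDerivAt_sInf`), whence its derivative is lower semicontinuous. No minimizer is ever
needed. -/

noncomputable section

/-! ### Compactness of monotone functions -/

/-- **Helly's selection theorem** for monotone functions with values in a compact interval. -/
theorem helly_selection {a b : ℝ} (u : ℕ → ℝ → Icc a b) (hu : ∀ n, Monotone (u n)) :
    ∃ σ : ℕ → ℕ, StrictMono σ ∧ ∃ v : ℝ → Icc a b,
      ∀ t, Tendsto (fun k => u (σ k) t) atTop (𝓝 (v t)) := by
  obtain ⟨v, hv⟩ : ∃ v, MapClusterPt v atTop u := exists_clusterPt_of_compactSpace _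
  have hmono : Monotone v := by
    have hc : IsClosed {w : ℝ → Icc a b | Monotone w} := isClosed_monotone
    refine hc.mem_of_frequently_of_tendsto (b := 𝓝 v) (f := id) ?_ tendsto_id
    exact ((mapClusterPt_iff_frequently.1 hv) · · |>.exists |> fun ⟨n, hn⟩ => ⟨u n, hn, hu n⟩) |>
      fun h => frequently_iff.2 fun {U} hU => h U hU
  -- A cluster point in the full product need not be the limit of a subsequence, but in a countable
  -- product it is. Off `C` the limit `v` is continuous, and monotonicity squeezes the values
  -- between those at nearby rationals.
  set C : Set ℝ := range ((↑) : ℚ → ℝ) ∪ {t | ¬ ContinuousAt v t} with hC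
  have hCc : C.Countable := (countable_range _).union hmono.countable_not_continuousAt
  have : Countable C := hCc.to_subtype
  have hcl : MapClusterPt (fun c : C => v c) atTop (fun n (c : C) => u n c) :=
    hv.continuousAt_comp (f := fun (w : ℝ → Icc a b) (c : C) => w c)
      (by fun_prop : Continuous _).continuousAt
  obtain ⟨σ, hσ, hlim⟩ := MapClusterPt.tendsto_subseq hcl
  rw [tendsto_pi_nhds] at hlim
  refine ⟨σ, hσ, v, fun t => ?_⟩
  by_cases ht : t ∈ C
  · exact hlim ⟨t, ht⟩
  have hct : ContinuousAt v t := by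
    by_contra h
    exact ht (Or.inr h)
  refine tendsto_order.2 ⟨fun c hc => ?_, fun c hc => ?_⟩
  · have h1 : ∀ᶠ s in 𝓝 t, c < v s := hct.eventually (lt_mem_nhds hc)
    obtain ⟨l, hl, hl'⟩ := (mem_nhdsLE_iff_exists_Ioc_subset (a := t)).1
      (nhdsWithin_le_nhds h1)
    obtain ⟨q, hq1, hq2⟩ := exists_rat_btwn (mem_Iio.1 hl)
    have h2 := hlim ⟨q, Or.inl ⟨q, rfl⟩⟩
    filter_upwards [h2.eventually (lt_mem_nhds (hl' ⟨hq1, hq2.le⟩))] with k hk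
    exact hk.trans_le (hu _ hq2.le)
  · have h1 : ∀ᶠ s in 𝓝 t, v s < c := hct.eventually (gt_mem_nhds hc)
    obtain ⟨l, hl, hl'⟩ := (mem_nhdsGE_iff_exists_Ico_subset (a := t)).1
      (nhdsWithin_le_nhds h1)
    obtain ⟨q, hq1, hq2⟩ := exists_rat_btwn (mem_Ioi.1 hl)
    have h2 := hlim ⟨q, Or.inl ⟨q, rfl⟩⟩
    filter_upwards [h2.eventually (gt_mem_nhds (hl' ⟨hq1.le, hq2⟩))] with k hk
    exact (hu _ hq1.le).trans_lt hk

/-! ### Stretches of the first coordinate and change of variables -/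

/-- Stretching the first coordinate of the plane. -/
def planeStretch (e : ℝ ≃ₜ ℝ) : ℝ × ℝ ≃ₜ ℝ × ℝ := e.prodCongr (Homeomorph.refl ℝ)

theorem planeStretch_apply (e : ℝ ≃ₜ ℝ) (x : ℝ × ℝ) : planeStretch e x = (e x.1, x.2) := rfl

/-- Smooth increasing diffeomorphisms of the line that fix `0` and `L`, with bounded derivatives. -/
structure IsStretch (L K : ℝ) (e : ℝ ≃ₜ ℝ) : Prop where
  strictMono : StrictMono e
  contDiff : ContDiff ℝ ∞ e
  contDiff_symm : ContDiff ℝ ∞ e.symm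
  deriv_le : ∀ x, deriv e x ≤ K
  deriv_symm_le : ∀ x, deriv e.symm x ≤ K
  map_zero : e 0 = 0
  map_right : e L = L

namespace IsStretch

variable {L K : ℝ} {e : ℝ ≃ₜ ℝ}

theorem symm (h : IsStretch L K e) : IsStretch L K e.symm where
  strictMono := fun x y hxy => by
    by_contra! hc
    have := h.strictMono.monotone hc
    simp at this
    exact absurd hxy this.not_gt
  contDiff := h.contDiff_symm
  contDiff_symm := h.contDiff
  deriv_le := h.deriv_symm_le
  deriv_symm_le := h.deriv_le
  map_zero := by rw [e.symm_apply_eq, h.map_zero]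
  map_right := by rw [e.symm_apply_eq, h.map_right]

theorem hasDerivAt (h : IsStretch L K e) (x : ℝ) : HasDerivAt e (deriv e x) x :=
  (h.contDiff.differentiable (by simp) x).hasDerivAt

theorem deriv_nonneg (h : IsStretch L K e) (x : ℝ) : 0 ≤ deriv e x :=
  h.strictMono.monotone.deriv_nonneg

theorem deriv_symm_mul (h : IsStretch L K e) (x : ℝ) : deriv e.symm (e x) * deriv e x = 1 := by
  have h1 := (h.symm.hasDerivAt (e x)).comp x (h.hasDerivAt x)
  have h2 : (e.symm ∘ e) = id := by ext; simp
  rw [h2] at h1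
  exact h1.unique (hasDerivAt_id x)

theorem deriv_pos (h : IsStretch L K e) (x : ℝ) : 0 < deriv e x := by
  refine (h.deriv_nonneg x).lt_of_ne' fun h0 => ?_
  have := h.deriv_symm_mul x
  rw [h0] at this
  simp at this

theorem contDiff_deriv (h : IsStretch L K e) : ContDiff ℝ ∞ (deriv e) := by
  have := h.contDiff
  exact (contDiff_infty_iff_deriv.1 this).2

theorem hasFDerivAt_planeStretch (h : IsStretch L K e) (x : ℝ × ℝ) :
    HasFDerivAt (planeStretch e)
      ((ContinuousLinearMap.toSpanSingleton ℝ (deriv e x.1)).prodMap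
        (ContinuousLinearMap.id ℝ ℝ)) x :=
  (h.hasDerivAt x.1).hasFDerivAt.prodMap x (hasFDerivAt_id x.2)

theorem det_fderiv (h : IsStretch L K e) (x : ℝ × ℝ) :
    |((ContinuousLinearMap.toSpanSingleton ℝ (deriv e x.1)).prodMap
        (ContinuousLinearMap.id ℝ ℝ)).det| = deriv e x.1 := by
  rw [ContinuousLinearMap.det, ContinuousLinearMap.coe_prodMap, LinearMap.det_prodMap]
  simp [abs_of_nonneg (h.deriv_nonneg _)]

theorem setIntegral_image (h : IsStretch L K e) {s : Set (ℝ × ℝ)} (hs : MeasurableSet s)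
    (G : ℝ × ℝ → ℝ) :
    ∫ x in planeStretch e '' s, G x = ∫ x in s, deriv e x.1 * G (planeStretch e x) := by
  rw [integral_image_eq_integral_abs_det_fderiv_smul volume hs
    (fun x _ => (h.hasFDerivAt_planeStretch x).hasFDerivWithinAt)
    (planeStretch e).injective.injOn]
  simp only [h.det_fderiv, smul_eq_mul]

theorem volume_image_le (h : IsStretch L K e) {s : Set (ℝ × ℝ)} (hs : MeasurableSet s) :
    volume (planeStretch e '' s) ≤ ENNReal.ofReal K * volume s := by
  rw [← lintegral_abs_det_fderiv_eq_addHaar_image volume hs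
    (fun x _ => (h.hasFDerivAt_planeStretch x).hasFDerivWithinAt)
    (planeStretch e).injective.injOn]
  simp only [h.det_fderiv]
  calc _ ≤ ∫⁻ x in s, ENNReal.ofReal K :=
        lintegral_mono fun x => ENNReal.ofReal_le_ofReal (h.deriv_le _)
    _ = _ := by simp

/-- The push-forward of Lebesgue measure is at most `K` times Lebesgue measure, by the volume bound
for the inverse stretch. -/
theorem memLp_comp (h : IsStretch L K e) {s : Set (ℝ × ℝ)} (hs : MeasurableSet s)
    {u : ℝ × ℝ → ℝ} (hu : MemLp u 2 (volume.restrict (planeStretch e '' s))) :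
    MemLp (fun x => u (planeStretch e x)) 2 (volume.restrict s) := by
  have hle : Measure.map (planeStretch e) (volume.restrict s) ≤
      ENNReal.ofReal K • volume.restrict (planeStretch e '' s) := by
    refine Measure.le_iff.2 fun A hA => ?_
    rw [Measure.map_apply (planeStretch e).measurable hA,
      Measure.restrict_apply ((planeStretch e).measurable hA), Measure.smul_apply,
      Measure.restrict_apply hA, smul_eq_mul]
    have h1 : planeStretch e ⁻¹' A ∩ s =
        planeStretch e.symm '' (A ∩ planeStretch e '' s) := by
      change _ = (planeStretch e).symm '' _
      ext x
      simp [Homeomorph.image_symm]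
    rw [h1]
    exact h.symm.volume_image_le
      (hA.inter ((planeStretch e).measurableEmbedding.measurableSet_image.2 hs))
  exact (planeStretch e).toMeasurableEquiv.memLp_map_measure_iff.1
    (hu.of_measure_le_smul ENNReal.ofReal_ne_top hle)

theorem fderiv_comp_planeStretch (h : IsStretch L K e) {φ : ℝ × ℝ → ℝ} (hφ : ContDiff ℝ ∞ φ)
    (x v : ℝ × ℝ) : fderiv ℝ (fun y => φ (planeStretch e y)) x v =
      fderiv ℝ φ (planeStretch e x) (deriv e x.1 * v.1, v.2) := by
  have h1 : HasFDerivAt φ _ (planeStretch e x) :=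
    (hφ.differentiable (by simp) (planeStretch e x)).hasFDerivAt
  have h2 := (h1.comp x (h.hasFDerivAt_planeStretch x)).fderiv
  change fderiv ℝ (φ ∘ planeStretch e) x v = _
  rw [h2]
  simp [Prod.map, mul_comm]

theorem contDiff_comp_planeStretch (h : IsStretch L K e) {φ : ℝ × ℝ → ℝ} (hφ : ContDiff ℝ ∞ φ) :
    ContDiff ℝ ∞ (fun y => φ (planeStretch e y)) :=
  hφ.comp ((h.contDiff.comp contDiff_fst).prodMk contDiff_snd)

end IsStretch

theorem tsupport_comp_planeStretch_subset (e : ℝ ≃ₜ ℝ) (φ : ℝ × ℝ → ℝ) :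
    tsupport (fun y => φ (planeStretch e y)) ⊆ planeStretch e ⁻¹' tsupport φ :=
  closure_minimal (fun _ hx => subset_tsupport φ hx)
    ((isClosed_tsupport φ).preimage (planeStretch e).continuous)

theorem planeStretch_symm_planeStretch (e : ℝ ≃ₜ ℝ) (x : ℝ × ℝ) :
    planeStretch e.symm (planeStretch e x) = x := (planeStretch e).symm_apply_apply x

theorem planeStretch_planeStretch_symm (e : ℝ ≃ₜ ℝ) (x : ℝ × ℝ) :
    planeStretch e (planeStretch e.symm x) = x := (planeStretch e).apply_symm_apply x

/-- The pull-back of a gradient by a stretch of the plane. -/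
def pullGradient (e : ℝ ≃ₜ ℝ) (p : ℝ × ℝ → ℝ × ℝ) (x : ℝ × ℝ) : ℝ × ℝ :=
  (deriv e x.1 * (p (planeStretch e x)).1, (p (planeStretch e x)).2)

/-! ### Pull-back of admissible displacements and of the energy -/

namespace Laminate

variable {D : Laminate}

theorem measurableSet_cracked (D : Laminate) (l : ℝ) : MeasurableSet (D.cracked l) :=
  (measurableSet_Ioo.prod measurableSet_Ioo).diff
    (measurableSet_Icc.prod (measurableSet_singleton 0))

variable {K : ℝ} {e : ℝ ≃ₜ ℝ}

theorem planeStretch_mem_cracked_iff (h : IsStretch D.L K e) {l : ℝ} {x : ℝ × ℝ} :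
    planeStretch e x ∈ D.cracked (e l) ↔ x ∈ D.cracked l := by
  have h0 : 0 < e x.1 ↔ 0 < x.1 := by
    conv_lhs => rw [← h.map_zero, h.strictMono.lt_iff_lt]
  have h0' : 0 ≤ e x.1 ↔ 0 ≤ x.1 := by
    conv_lhs => rw [← h.map_zero, h.strictMono.le_iff_le]
  have hL : e x.1 < D.L ↔ x.1 < D.L := by
    conv_lhs => rw [← h.map_right, h.strictMono.lt_iff_lt]
  simp [cracked, body, crack, planeStretch_apply, h0, h0', hL, h.strictMono.le_iff_le]

theorem image_cracked (h : IsStretch D.L K e) (l : ℝ) :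
    planeStretch e '' D.cracked l = D.cracked (e l) := by
  ext y
  rw [← Homeomorph.coe_toEquiv, Equiv.image_eq_preimage_symm]
  rw [mem_preimage, ← planeStretch_mem_cracked_iff h]
  change planeStretch e ((planeStretch e).symm y) ∈ _ ↔ _
  simp

theorem setIntegral_cracked (h : IsStretch D.L K e) (l : ℝ) (G : ℝ × ℝ → ℝ) :
    ∫ x in D.cracked (e l), G x =
      ∫ x in D.cracked l, deriv e x.1 * G (planeStretch e x) := by
  rw [← image_cracked h, h.setIntegral_image (D.measurableSet_cracked l)]

theorem memLp_comp_stretch (h : IsStretch D.L K e) {l : ℝ} {u : ℝ × ℝ → ℝ}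
    (hu : MemLp u 2 (volume.restrict (D.cracked (e l)))) :
    MemLp (fun x => u (planeStretch e x)) 2 (volume.restrict (D.cracked l)) :=
  h.memLp_comp (D.measurableSet_cracked l) (by rwa [image_cracked h])

/-- The chain rule factor of the horizontal derivative cancels the Jacobian, so no weight appears.
-/
theorem integral_comp_mul_fderiv_fst (h : IsStretch D.L K e) (l : ℝ) (u : ℝ × ℝ → ℝ)
    {φ : ℝ × ℝ → ℝ} (hφ : ContDiff ℝ ∞ φ) :
    ∫ x in D.cracked l, u (planeStretch e x) * fderiv ℝ φ x (1, 0) =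
      ∫ x in D.cracked (e l),
        u x * fderiv ℝ (fun y => φ (planeStretch e.symm y)) x (1, 0) := by
  rw [setIntegral_cracked h]
  refine integral_congr_ae (ae_of_all _ fun x => ?_)
  simp only [h.symm.fderiv_comp_planeStretch hφ, planeStretch_symm_planeStretch]
  have h1 : (deriv e.symm (planeStretch e x).1 * ((1 : ℝ), (0 : ℝ)).1, ((1 : ℝ), (0 : ℝ)).2) =
      deriv e.symm (e x.1) • ((1 : ℝ), (0 : ℝ)) := by
    simp [planeStretch_apply]
  rw [h1, map_smul, smul_eq_mul]
  linear_combination (-(u (planeStretch e x) * fderiv ℝ φ x (1, 0))) * h.deriv_symm_mul x.1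

theorem integral_pullGradient_fst_mul (h : IsStretch D.L K e) (l : ℝ) (p : ℝ × ℝ → ℝ × ℝ)
    (φ : ℝ × ℝ → ℝ) :
    ∫ x in D.cracked l, (pullGradient e p x).1 * φ x =
      ∫ x in D.cracked (e l), (p x).1 * φ (planeStretch e.symm x) := by
  rw [setIntegral_cracked h]
  refine integral_congr_ae (ae_of_all _ fun x => ?_)
  simp only [planeStretch_symm_planeStretch, pullGradient]
  ring

theorem IsSobolev.stretch (h : IsStretch D.L K e) {l : ℝ} {u : ℝ × ℝ → ℝ} {p : ℝ × ℝ → ℝ × ℝ}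
    (hu : IsSobolev (D.cracked (e l)) u p) :
    IsSobolev (D.cracked l) (fun x => u (planeStretch e x)) (pullGradient e p) where
  memLp := memLp_comp_stretch h hu.memLp
  memLp_fst := by
    refine (memLp_comp_stretch h hu.memLp_fst).of_le_mul (c := K) ?_ (ae_of_all _ fun x => ?_)
    · exact ((h.contDiff_deriv.continuous.comp continuous_fst).aestronglyMeasurable).mul
        (memLp_comp_stretch h hu.memLp_fst).aestronglyMeasurable
    · simp only [pullGradient, norm_mul]
      refine mul_le_mul_of_nonneg_right ?_ (norm_nonneg _)
      rw [Real.norm_of_nonneg (h.deriv_nonneg _)]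
      exact h.deriv_le _
  memLp_snd := memLp_comp_stretch h hu.memLp_snd
  hasWeakGradient := by
    intro φ hφ hc hs
    have hs' : tsupport (fun y => φ (planeStretch e.symm y)) ⊆ D.cracked (e l) := by
      intro y hy
      have := hs (tsupport_comp_planeStretch_subset _ _ hy)
      rw [← planeStretch_mem_cracked_iff h, planeStretch_planeStretch_symm] at this
      exact this
    have hc' : HasCompactSupport (fun y => φ (planeStretch e.symm y)) :=
      hc.comp_homeomorph (planeStretch e.symm)
    have hφ' := h.symm.contDiff_comp_planeStretch hφ
    constructor
    · rw [integral_comp_mul_fderiv_fst h l u hφ, integral_pullGradient_fst_mul h,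
        (hu.hasWeakGradient _ hφ' hc' hs').1]
    · have hd : ContDiff ℝ ∞ (fun y : ℝ × ℝ => deriv e.symm y.1) :=
        h.symm.contDiff_deriv.comp contDiff_fst
      -- The vertical derivative produces no factor against the Jacobian, so the test function is
      -- weighted by the derivative of the inverse stretch; this weight depends on the first
      -- coordinate only and passes through ∂₂.
      have key := (hu.hasWeakGradient
        (fun y => deriv e.symm y.1 * φ (planeStretch e.symm y)) (hd.mul hφ')
        hc'.mul_left ((tsupport_mul_subset_right).trans hs')).2
      rw [setIntegral_cracked h, setIntegral_cracked h] at key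
      convert key using 1
      · refine integral_congr_ae (ae_of_all _ fun x => ?_)
        have h2 : fderiv ℝ (fun y : ℝ × ℝ => deriv e.symm y.1) (planeStretch e x) (0, 1) = 0 := by
          have h3 := ((h.symm.contDiff_deriv.differentiable (by simp)
            (planeStretch e x).1).hasFDerivAt.comp _ (hasFDerivAt_fst (𝕜 := ℝ) (p := planeStretch e x)))
          have h4 := h3.fderiv
          change fderiv ℝ (deriv e.symm ∘ Prod.fst) _ _ = 0
          rw [h4]
          simp
        have h6 : fderiv ℝ (fun y => deriv e.symm y.1 * φ (planeStretch e.symm y))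
            (planeStretch e x) = _ :=
          fderiv_fun_mul (hd.differentiable (by simp) _) (hφ'.differentiable (by simp) _)
        simp only [h6, _root_.add_apply, _root_.smul_apply, h2,
          h.symm.fderiv_comp_planeStretch hφ, planeStretch_symm_planeStretch, mul_zero, smul_eq_mul,
          add_zero]
        simp only [planeStretch_apply]
        linear_combination (-(u (e x.1, x.2) * fderiv ℝ φ x (0, 1))) * h.deriv_symm_mul x.1
      · congr 1
        refine integral_congr_ae (ae_of_all _ fun x => ?_)
        simp only [planeStretch_symm_planeStretch, pullGradient]
        simp only [planeStretch_apply]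
        linear_combination (-((p (e x.1, x.2)).2 * φ x)) * h.deriv_symm_mul x.1

/-- The stretch fixes 0 and `L`, so the boundary terms of Green's formula do not change. -/
theorem HasTrace.stretch (h : IsStretch D.L K e) {l : ℝ} {u : ℝ × ℝ → ℝ} {p : ℝ × ℝ → ℝ × ℝ}
    {g : ℝ × ℝ → ℝ} (hu : D.HasTrace (e l) u p g) :
    D.HasTrace l (fun x => u (planeStretch e x)) (pullGradient e p) g := by
  intro φ hφ hc hs
  rw [integral_comp_mul_fderiv_fst h l u hφ, integral_pullGradient_fst_mul h]
  have key := hu _ (h.symm.contDiff_comp_planeStretch hφ)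
    (hc.comp_homeomorph (planeStretch e.symm)) (by
      intro y hy
      have h1 := hs (tsupport_comp_planeStretch_subset _ _ hy)
      have h2 : e.symm y.1 ≤ l ↔ y.1 ≤ e l := by
        rw [← h.strictMono.le_iff_le, e.apply_symm_apply]
      have h3 : 0 ≤ e.symm y.1 ↔ 0 ≤ y.1 := by
        rw [← h.strictMono.le_iff_le, e.apply_symm_apply, h.map_zero]
      simpa [crack, planeStretch_apply, h2, h3] using h1)
  rw [key]
  simp only [planeStretch_apply, h.symm.map_zero, h.symm.map_right]

theorem IsAdmissible.stretch (h : IsStretch D.L K e) {l : ℝ} {u : ℝ × ℝ → ℝ}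
    {p : ℝ × ℝ → ℝ × ℝ} {g : ℝ × ℝ → ℝ} (hu : D.IsAdmissible g (e l) u p) :
    D.IsAdmissible g l (fun x => u (planeStretch e x)) (pullGradient e p) :=
  ⟨IsSobolev.stretch h hu.1, HasTrace.stretch h hu.2⟩

/-- The elastic energy, in the coordinates before a stretch of the first coordinate with
derivative `w`, as a function of the pulled-back gradient. -/
def stretchedEnergy (D : Laminate) (w : ℝ → ℝ) (n : ℕ) (l : ℝ) (p : ℝ × ℝ → ℝ × ℝ) : ℝ :=
  1 / 2 * ∫ x in D.cracked l,
    (D.layered D.μA₁ D.μB₁ n x.1 * (p x).1 ^ 2 / w x.1 +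
      D.layered D.μA₂ D.μB₂ n x.1 * (p x).2 ^ 2 * w x.1)

/-- The hypothesis `hl` says that the stretch moves no point to a different material. The Jacobian
multiplies the vertical part; in the horizontal part it meets the inverse square of the derivative.
-/
theorem elasticEnergy_eq_stretchedEnergy (h : IsStretch D.L K e) {n : ℕ}
    (hl : ∀ a b x, D.layered a b n (e x) = D.layered a b n x) (l : ℝ) (p : ℝ × ℝ → ℝ × ℝ) :
    D.elasticEnergy n (e l) p = D.stretchedEnergy (deriv e) n l (pullGradient e p) := by
  rw [elasticEnergy, stretchedEnergy, setIntegral_cracked h]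
  congr 1
  refine integral_congr_ae (ae_of_all _ fun x => ?_)
  have := h.deriv_pos x.1
  simp only [planeStretch_apply, pullGradient, hl]
  field_simp

/-- The gradients of the admissible displacements. -/
def admissibleGradients (D : Laminate) (g : ℝ × ℝ → ℝ) (l : ℝ) : Set (ℝ × ℝ → ℝ × ℝ) :=
  {p | ∃ u, D.IsAdmissible g l u p}

theorem condensedEnergy_eq_sInf (D : Laminate) (g : ℝ × ℝ → ℝ) (n : ℕ) (l : ℝ) :
    D.condensedEnergy g n l = sInf (D.elasticEnergy n l '' D.admissibleGradients g l) := by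
  rw [condensedEnergy]
  congr 1
  ext x
  constructor
  · rintro ⟨u, p, h, rfl⟩
    exact ⟨p, ⟨u, h⟩, rfl⟩
  · rintro ⟨p, ⟨u, h⟩, rfl⟩
    exact ⟨u, p, h, rfl⟩

theorem pullGradient_pullGradient_symm (h : IsStretch D.L K e) (p : ℝ × ℝ → ℝ × ℝ) :
    pullGradient e (pullGradient e.symm p) = p := by
  ext x
  · simp only [pullGradient, planeStretch_symm_planeStretch]
    simp only [planeStretch_apply]
    linear_combination (p x).1 * h.deriv_symm_mul x.1
  · simp only [pullGradient, planeStretch_symm_planeStretch]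

/-- The pull-back is a bijection between the admissible gradients for the two crack lengths, so all
dependence on the stretch moves into the weight `deriv e`. -/
theorem condensedEnergy_stretch (h : IsStretch D.L K e) {n : ℕ}
    (hl : ∀ a b x, D.layered a b n (e x) = D.layered a b n x) (g : ℝ × ℝ → ℝ) (l : ℝ) :
    D.condensedEnergy g n (e l) =
      sInf (D.stretchedEnergy (deriv e) n l '' D.admissibleGradients g l) := by
  rw [condensedEnergy_eq_sInf]
  congr 1
  ext x
  constructor
  · rintro ⟨p, ⟨u, hu⟩, rfl⟩
    exact ⟨pullGradient e p, ⟨_, hu.stretch h⟩, (elasticEnergy_eq_stretchedEnergy h hl l p).symm⟩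
  · rintro ⟨p, ⟨u, hu⟩, rfl⟩
    refine ⟨pullGradient e.symm p, ⟨_, IsAdmissible.stretch (l := e l) h.symm
      (by rwa [e.symm_apply_apply])⟩, ?_⟩
    rw [elasticEnergy_eq_stretchedEnergy h hl, pullGradient_pullGradient_symm h]

/-- The only convexity used: it allows the energy of a midpoint to be compared with the infimum. -/
theorem admissibleGradients_midpoint {g : ℝ × ℝ → ℝ} {l : ℝ} {p q : ℝ × ℝ → ℝ × ℝ}
    (hp : p ∈ D.admissibleGradients g l) (hq : q ∈ D.admissibleGradients g l) :
    (fun x => (((p x).1 + (q x).1) / 2, ((p x).2 + (q x).2) / 2)) ∈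
      D.admissibleGradients g l := by
  obtain ⟨u, hu, htu⟩ := hp
  obtain ⟨v, hv, htv⟩ := hq
  have mid : ∀ {a b : ℝ × ℝ → ℝ}, MemLp a 2 (volume.restrict (D.cracked l)) →
      MemLp b 2 (volume.restrict (D.cracked l)) →
      MemLp (fun x => (a x + b x) / 2) 2 (volume.restrict (D.cracked l)) := fun ha hb => by
    simpa [div_eq_inv_mul] using (ha.add hb).const_mul (2⁻¹ : ℝ)
  have int : ∀ {a b c : ℝ × ℝ → ℝ}, MemLp a 2 (volume.restrict (D.cracked l)) →
      MemLp b 2 (volume.restrict (D.cracked l)) → Continuous c → HasCompactSupport c →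
      ∫ x in D.cracked l, (a x + b x) / 2 * c x =
        ((∫ x in D.cracked l, a x * c x) + ∫ x in D.cracked l, b x * c x) / 2 := by
    intro a b c ha hb hc hcs
    have hcL : MemLp c 2 (volume.restrict (D.cracked l)) := (hc.memLp_of_hasCompactSupport hcs).restrict _
    have h1 : ∫ x in D.cracked l, (a x * c x + b x * c x) = _ :=
      integral_add (ha.integrable_mul hcL) (hb.integrable_mul hcL)
    rw [← h1, ← integral_div]
    refine integral_congr_ae (ae_of_all _ fun x => ?_)
    ring
  have hder : ∀ {φ : ℝ × ℝ → ℝ} (w : ℝ × ℝ), ContDiff ℝ ∞ φ → HasCompactSupport φ →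
      Continuous (fun x => fderiv ℝ φ x w) ∧ HasCompactSupport (fun x => fderiv ℝ φ x w) :=
    fun w hφ hc => ⟨(hφ.continuous_fderiv (by simp)).clm_apply continuous_const,
      hc.fderiv_apply ℝ w⟩
  refine ⟨fun x => (u x + v x) / 2, ⟨mid hu.memLp hv.memLp, mid hu.memLp_fst hv.memLp_fst,
    mid hu.memLp_snd hv.memLp_snd, fun φ hφ hc hs => ⟨?_, ?_⟩⟩, fun φ hφ hc hs => ?_⟩
  · rw [int hu.memLp hv.memLp (hder _ hφ hc).1 (hder _ hφ hc).2,
      int hu.memLp_fst hv.memLp_fst hφ.continuous hc, (hu.hasWeakGradient φ hφ hc hs).1,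
      (hv.hasWeakGradient φ hφ hc hs).1]
    ring
  · rw [int hu.memLp hv.memLp (hder _ hφ hc).1 (hder _ hφ hc).2,
      int hu.memLp_snd hv.memLp_snd hφ.continuous hc, (hu.hasWeakGradient φ hφ hc hs).2,
      (hv.hasWeakGradient φ hφ hc hs).2]
    ring
  · rw [int hu.memLp hv.memLp (hder _ hφ hc).1 (hder _ hφ hc).2,
      int hu.memLp_fst hv.memLp_fst hφ.continuous hc, htu φ hφ hc hs, htv φ hφ hc hs]
    ring

/-! ### Quadratic homogeneity in the boundary datum -/

theorem IsAdmissible.smul {g : ℝ × ℝ → ℝ} {l : ℝ} {u : ℝ × ℝ → ℝ} {p : ℝ × ℝ → ℝ × ℝ}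
    (h : D.IsAdmissible g l u p) (c : ℝ) : D.IsAdmissible (c • g) l (c • u) (c • p) := by
  obtain ⟨hu, ht⟩ := h
  refine ⟨⟨hu.memLp.const_smul c, hu.memLp_fst.const_smul c, hu.memLp_snd.const_smul c,
    fun φ hφ hc hs => ?_⟩, fun φ hφ hc hs => ?_⟩
  · obtain ⟨h1, h2⟩ := hu.hasWeakGradient φ hφ hc hs
    simp only [Pi.smul_apply, Prod.smul_fst, Prod.smul_snd, smul_eq_mul, mul_assoc,
      integral_const_mul, h1, h2, mul_neg, and_self]
  · simp only [Pi.smul_apply, Prod.smul_fst, smul_eq_mul, mul_assoc,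
      integral_const_mul, ht φ hφ hc hs]
    ring

theorem isAdmissible_zero (l : ℝ) : D.IsAdmissible 0 l 0 0 := by
  refine ⟨⟨MemLp.zero, MemLp.zero, MemLp.zero, fun φ _ _ _ => ?_⟩, fun φ _ _ _ => ?_⟩ <;> simp

theorem layered_pos {a b : ℝ} (ha : 0 < a) (hb : 0 < b) (n : ℕ) (x : ℝ) :
    0 < D.layered a b n x := by
  unfold layered
  split_ifs <;> assumption

theorem elasticEnergy_nonneg (n : ℕ) (l : ℝ) (p : ℝ × ℝ → ℝ × ℝ) :
    0 ≤ D.elasticEnergy n l p := by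
  refine mul_nonneg (by norm_num) (integral_nonneg fun x => ?_)
  have h1 := (layered_pos (D := D) D.μA₁_pos D.μB₁_pos n x.1).le
  have h2 := (layered_pos (D := D) D.μA₂_pos D.μB₂_pos n x.1).le
  simp only [Pi.zero_apply]
  positivity

theorem elasticEnergy_smul (c : ℝ) (n : ℕ) (l : ℝ) (p : ℝ × ℝ → ℝ × ℝ) :
    D.elasticEnergy n l (c • p) = c ^ 2 * D.elasticEnergy n l p := by
  unfold elasticEnergy
  rw [mul_left_comm (c ^ 2), ← integral_const_mul (c ^ 2)]
  refine congrArg (fun r : ℝ => 1 / 2 * r) (integral_congr_ae (ae_of_all _ fun x => ?_))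
  simp only [Pi.smul_apply, Prod.smul_fst, Prod.smul_snd, smul_eq_mul]
  ring

theorem condensedEnergy_smul (c : ℝ) (g : ℝ × ℝ → ℝ) (n : ℕ) (l : ℝ) :
    D.condensedEnergy (c • g) n l = c ^ 2 * D.condensedEnergy g n l := by
  rcases eq_or_ne c 0 with rfl | hc
  · simp only [zero_smul, ne_eq, OfNat.ofNat_ne_zero, not_false_eq_true, zero_pow, zero_mul]
    refine le_antisymm (csInf_le ⟨0, ?_⟩ ⟨0, 0, isAdmissible_zero l, ?_⟩) (Real.sInf_nonneg ?_)
    · rintro _ ⟨u, p, -, rfl⟩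
      exact elasticEnergy_nonneg n l p
    · simp [elasticEnergy]
    · rintro _ ⟨u, p, -, rfl⟩
      exact elasticEnergy_nonneg n l p
  · rw [condensedEnergy, condensedEnergy, ← smul_eq_mul, ← Real.sInf_smul_of_nonneg (sq_nonneg c)]
    congr 1
    ext x
    rw [mem_smul_set]
    constructor
    · rintro ⟨u, p, h, rfl⟩
      refine ⟨_, ⟨c⁻¹ • u, c⁻¹ • p, ?_, rfl⟩, ?_⟩
      · simpa [smul_smul, hc] using h.smul c⁻¹
      · rw [elasticEnergy_smul, smul_eq_mul]
        field_simp
    · rintro ⟨_, ⟨u, p, h, rfl⟩, rfl⟩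
      exact ⟨_, _, h.smul c, by rw [elasticEnergy_smul, smul_eq_mul]⟩

theorem energyRelease_smul (c : ℝ) (g : ℝ × ℝ → ℝ) (n : ℕ) (l : ℝ) :
    D.energyRelease (c • g) n l = ENNReal.ofReal (c ^ 2) * D.energyRelease g n l := by
  have h1 : D.condensedEnergy (c • g) n = fun l => c ^ 2 * D.condensedEnergy g n l :=
    funext fun l => condensedEnergy_smul c g n l
  have h2 : ∀ s, ENNReal.ofReal (-deriv (D.condensedEnergy (c • g) n) s) =
      ENNReal.ofReal (c ^ 2) * ENNReal.ofReal (-deriv (D.condensedEnergy g n) s) := by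
    intro s
    rw [h1, deriv_const_mul_field, ← mul_neg, ENNReal.ofReal_mul (sq_nonneg c)]
  unfold energyRelease
  split_ifs
  · simp
  · simp only [h2]
    exact ENNReal.liminf_const_mul_of_ne_top ENNReal.ofReal_ne_top
  · exact h2 l

end Laminate

/-! ### Derivatives of infima and their semicontinuity -/

/-- The infimum of a family of functions `h ↦ F h p` is differentiable at `0` if the remainders of
their first order expansions are uniformly controlled and the first order coefficients `b p` of
almost minimizers of `F 0` are close to each other. -/
theorem exists_hasDerivAt_sInf {X : Type*} {P : Set X} {F : ℝ → X → ℝ} {b : X → ℝ} {h₀ C : ℝ}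
    (hh₀ : 0 < h₀) (hC : 0 ≤ C) (hF : ∀ h, |h| ≤ h₀ → ∀ p ∈ P, 0 ≤ F h p)
    (hexp : ∀ h, |h| ≤ h₀ → ∀ p ∈ P, |F h p - F 0 p - h * b p| ≤ C * h ^ 2 * F 0 p)
    (hb : ∀ p ∈ P, ∀ q ∈ P, ∀ κ > 0, |b p - b q| ≤
      C * (κ * (F 0 p + F 0 q) + κ⁻¹ * (F 0 p + F 0 q - 2 * sInf (F 0 '' P)))) :
    ∃ d, HasDerivAt (fun h => sInf (F h '' P)) d 0 ∧ ∀ h, |h| ≤ h₀ →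
      sInf (F h '' P) ≤ sInf (F 0 '' P) + h * d + C * h ^ 2 * sInf (F 0 '' P) := by
  rcases P.eq_empty_or_nonempty with rfl | hP
  · exact ⟨0, by simpa using hasDerivAt_const (0 : ℝ) (0 : ℝ), by simp⟩
  have hbdd : ∀ h, |h| ≤ h₀ → BddBelow (F h '' P) := fun h hh =>
    ⟨0, by rintro _ ⟨p, hp, rfl⟩; exact hF h hh p hp⟩
  have h0 : |(0 : ℝ)| ≤ h₀ := by simpa using hh₀.le
  set E := sInf (F 0 '' P) with hE
  have hE0 : 0 ≤ E := Real.sInf_nonneg (by rintro _ ⟨p, hp, rfl⟩; exact hF 0 h0 p hp)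
  have hEle : ∀ p ∈ P, E ≤ F 0 p := fun p hp => csInf_le (hbdd 0 h0) ⟨p, hp, rfl⟩
  obtain ⟨x, -, hx, hxP⟩ := exists_seq_tendsto_sInf (hP.image (F 0)) (hbdd 0 h0)
  choose p hpP hpx using hxP
  obtain ⟨M, hM⟩ := hx.bddAbove_range
  have hxM : ∀ j, F 0 (p j) ≤ M := fun j => by rw [hpx]; exact hM ⟨j, rfl⟩
  -- With κ = 1 the hypothesis `hb` bounds `b` along a minimizing sequence; a limit point `d` of
  -- these coefficients is the candidate derivative.
  obtain ⟨d, -, σ, hσ, hd⟩ := tendsto_subseq_of_bounded (x := fun j => b (p j))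
    (s := Metric.closedBall (b (p 0)) (C * (M + M + (M + M - 2 * E)))) Metric.isBounded_closedBall
    (fun j => by
      rw [Metric.mem_closedBall, Real.dist_eq]
      refine (hb _ (hpP j) _ (hpP 0) 1 one_pos).trans (mul_le_mul_of_nonneg_left ?_ hC)
      have := hxM j
      have := hxM 0
      linarith)
  have hFσ : Tendsto (fun j => F 0 (p (σ j))) atTop (𝓝 E) := by
    simp only [hpx]
    exact hx.comp hσ.tendsto_atTop
  have hup : ∀ h, |h| ≤ h₀ → sInf (F h '' P) ≤ E + h * d + C * h ^ 2 * E := by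
    intro h hh
    refine ge_of_tendsto ((hFσ.add (hd.const_mul h)).add (hFσ.const_mul (C * h ^ 2)))
      (Eventually.of_forall fun j => ?_)
    have h1 := csInf_le (hbdd h hh) ⟨p (σ j), hpP _, rfl⟩
    have h2 := (abs_le.1 (hexp h hh _ (hpP (σ j)))).2
    simp only [Function.comp]
    linarith
  have hbd : ∀ q ∈ P, ∀ κ > 0, |b q - d| ≤ C * (κ * (F 0 q + E) + κ⁻¹ * (F 0 q - E)) := by
    intro q hq κ hκ
    refine le_of_tendsto_of_tendsto' ((tendsto_const_nhds (x := b q)).sub hd).abs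
      ((((hFσ.const_add (F 0 q)).const_mul κ).add
        (((hFσ.const_add (F 0 q)).sub_const (2 * E)).const_mul κ⁻¹)).const_mul C)
      (fun j => hb q hq _ (hpP _) κ hκ) |>.trans_eq ?_
    ring
  refine ⟨d, ?_, hup⟩
  rw [hasDerivAt_iff_isLittleO]
  refine Asymptotics.IsLittleO.of_bound fun ε hε => ?_
  -- With F 0 q = E + excess, this κ keeps the error proportional to E below ε|h|/2. The large
  -- factor κ⁻¹ only multiplies the excess, and for small h (`e3`) the excess absorbs it.
  set κ : ℝ := ε / (4 * (C * E + 1)) with hκdef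
  have hCE : 0 ≤ C * E := mul_nonneg hC hE0
  have hκ : 0 < κ := by positivity
  have hκε : 2 * κ * (C * E) ≤ ε / 2 := by
    rw [hκdef, show 2 * (ε / (4 * (C * E + 1))) * (C * E) = ε / 2 * (C * E / (C * E + 1)) by
      field_simp; ring]
    exact mul_le_of_le_one_right (by positivity) ((div_le_one (by positivity)).2 (by linarith))
  have e1 : ∀ᶠ h in 𝓝 (0 : ℝ), |h| ≤ h₀ :=
    (continuous_abs.tendsto' (0 : ℝ) 0 abs_zero).eventually (ge_mem_nhds hh₀)
  have e2 : ∀ᶠ h in 𝓝 (0 : ℝ), C * |h| * E ≤ ε / 2 :=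
    ((by fun_prop : Continuous fun h : ℝ => C * |h| * E).tendsto' 0 0 (by simp)).eventually
      (ge_mem_nhds (by positivity))
  have e3 : ∀ᶠ h in 𝓝 (0 : ℝ), C * h ^ 2 + |h| * C * κ + |h| * C * κ⁻¹ ≤ 1 :=
    ((by fun_prop : Continuous fun h : ℝ => C * h ^ 2 + |h| * C * κ + |h| * C * κ⁻¹).tendsto' 0 0
      (by simp)).eventually (ge_mem_nhds one_pos)
  filter_upwards [e1, e2, e3] with h h1 h2 h3
  simp only [sub_zero, smul_eq_mul, Real.norm_eq_abs]
  have hsq : h ^ 2 = |h| * |h| := by rw [← sq, sq_abs]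
  have ha := abs_nonneg h
  rw [abs_le]
  constructor
  · suffices E + h * d - ε * |h| ≤ sInf (F h '' P) by linarith
    refine le_csInf (hP.image _) ?_
    rintro _ ⟨q, hq, rfl⟩
    have g1 := (abs_le.1 (hexp h h1 q hq)).1
    have g2 : |h * (b q - d)| ≤ |h| * (C * (κ * (F 0 q + E) + κ⁻¹ * (F 0 q - E))) := by
      rw [abs_mul]
      exact mul_le_mul_of_nonneg_left (hbd q hq κ hκ) ha
    have g3 := (abs_le.1 g2).1
    have g4 := sub_nonneg.2 (hEle q hq)
    have g5 := mul_nonneg g4 (sub_nonneg.2 h3)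
    have g6 := mul_le_mul_of_nonneg_left hκε ha
    have g7 := mul_le_mul_of_nonneg_left h2 ha
    have g8 : C * h ^ 2 * E = |h| * (C * |h| * E) := by rw [hsq]; ring
    linear_combination g1 + g3 + g5 + g6 + g7 + g8
  · have g1 := hup h h1
    have g7 := mul_le_mul_of_nonneg_left h2 ha
    have g8 : C * h ^ 2 * E = |h| * (C * |h| * E) := by rw [hsq]; ring
    have g9 := mul_nonneg hε.le ha
    linarith

/-- Lower semicontinuity of the derivative of a function that lies, uniformly, below the parabolas
tangent to its graph. -/
theorem eventually_lt_deriv_of_le_parabola {E : ℝ → ℝ} {x h₀ C : ℝ} (hh₀ : 0 < h₀)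
    (hd : ∀ᶠ y in 𝓝 x, DifferentiableAt ℝ E y)
    (hE : ∀ᶠ y in 𝓝 x, ∀ h, |h| ≤ h₀ → E (y + h) ≤ E y + h * deriv E y + C * h ^ 2 * E y)
    {c : ℝ} (hc : c < deriv E x) : ∀ᶠ y in 𝓝 x, c < deriv E y := by
  have hx := hd.self_of_nhds
  -- For fixed h > 0 the parabola bound reads E'(y) ≥ (E(y+h) − E(y))/h − C h E(y). The right side
  -- tends to E'(x) at y = x as h → 0⁺, so some h makes it exceed `c` there; continuity in y then
  -- does the rest.
  have h1 : Tendsto (fun h : ℝ => h⁻¹ * (E (x + h) - E x) - C * h * E x) (𝓝[>] 0)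
      (𝓝 (deriv E x - C * 0 * E x)) := by
    have h2 := (hasDerivAt_iff_tendsto_slope_zero.1 hx.hasDerivAt).mono_left
      (nhdsWithin_mono 0 (fun y (hy : 0 < y) => hy.ne') : 𝓝[>] (0 : ℝ) ≤ 𝓝[≠] 0)
    exact h2.sub (((by fun_prop : Continuous fun h : ℝ => C * h * E x).tendsto 0).mono_left
      nhdsWithin_le_nhds)
  have h3 : ∀ᶠ h in 𝓝[>] (0 : ℝ), DifferentiableAt ℝ E (x + h) :=
    (((by fun_prop : Continuous fun h : ℝ => x + h).tendsto' 0 x (by simp)).mono_left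
        nhdsWithin_le_nhds).eventually hd
  have h4 : ∀ᶠ h in 𝓝[>] (0 : ℝ), h ≤ h₀ := nhdsWithin_le_nhds (ge_mem_nhds hh₀)
  obtain ⟨h, g1, g2, g3, g4⟩ := ((h1.eventually (lt_mem_nhds (by simpa using hc))).and
    (h3.and (h4.and self_mem_nhdsWithin))).exists
  have g4 : 0 < h := g4
  have k1 : Tendsto (fun y => h⁻¹ * (E (y + h) - E y) - C * h * E y) (𝓝 x)
      (𝓝 (h⁻¹ * (E (x + h) - E x) - C * h * E x)) := by
    have k2 : Tendsto (fun y => E (y + h)) (𝓝 x) (𝓝 (E (x + h))) :=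
      g2.continuousAt.tendsto.comp ((continuous_add_const h).tendsto x)
    exact ((k2.sub hx.continuousAt).const_mul _).sub (hx.continuousAt.tendsto.const_mul _)
  filter_upwards [k1.eventually (lt_mem_nhds g1), hE] with y y1 y2
  have y3 := y2 h (by rwa [abs_of_pos g4])
  refine y1.trans_le ?_
  rw [sub_le_iff_le_add, inv_mul_le_iff₀ g4]
  linear_combination y3

/-! ### Construction of stretches -/

/-- Small smooth perturbations of the identity, compatible with the end points, are stretches. -/
theorem exists_isStretch_perturbation {L M h : ℝ} {θ : ℝ → ℝ} (hθ : ContDiff ℝ ∞ θ) (h0 : θ 0 = 0)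
    (hL : θ L = 0) (hθ0 : ∀ x, |θ x| ≤ 1) (hM : ∀ x, |deriv θ x| ≤ M) (hh : |h| * M ≤ 1 / 2) :
    ∃ e : ℝ ≃ₜ ℝ, IsStretch L 2 e ∧ (∀ x, e x = x + h * θ x) ∧
      deriv e = fun x => 1 + h * deriv θ x := by
  have hd : ∀ x, HasDerivAt (fun x => x + h * θ x) (1 + h * deriv θ x) x := fun x =>
    (hasDerivAt_id x).add ((hθ.differentiable (by simp) x).hasDerivAt.const_mul h)
  have habs : ∀ x, |h * deriv θ x| ≤ 1 / 2 := fun x => by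
    rw [abs_mul]
    exact (mul_le_mul_of_nonneg_left (hM x) (abs_nonneg h)).trans hh
  have hpos : ∀ x, 1 / 2 ≤ 1 + h * deriv θ x := fun x => by linarith [(abs_le.1 (habs x)).1]
  have hmono : StrictMono fun x => x + h * θ x := strictMono_of_deriv_pos fun x => by
    rw [(hd x).deriv]
    linarith [hpos x]
  have hcd : ContDiff ℝ ∞ fun x => x + h * θ x := contDiff_id.add (contDiff_const.mul hθ)
  have hb : ∀ x, |h * θ x| ≤ |h| := fun x => by
    rw [abs_mul]
    exact mul_le_of_le_one_right (abs_nonneg h) (hθ0 x)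
  have hsurj : Function.Surjective fun x => x + h * θ x := by
    refine hcd.continuous.surjective ?_ ?_
    · exact tendsto_atTop_mono (fun x => by linarith [(abs_le.1 (hb x)).1] : ∀ x, x + -|h| ≤ _)
        (tendsto_atTop_add_const_right _ _ tendsto_id)
    · exact tendsto_atBot_mono (fun x => by linarith [(abs_le.1 (hb x)).2] : ∀ x, _ ≤ x + |h|)
        (tendsto_atBot_add_const_right _ _ tendsto_id)
  set e : ℝ ≃ₜ ℝ := (hmono.orderIsoOfSurjective _ hsurj).toHomeomorph with he
  have hex : ∀ x, e x = x + h * θ x := fun x => rfl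
  have hee : (e : ℝ → ℝ) = fun x => x + h * θ x := rfl
  have hde : deriv e = fun x => 1 + h * deriv θ x := by
    ext x
    rw [hee, (hd x).deriv]
  have hsd : ContDiff ℝ ∞ e.symm :=
    e.contDiff_symm_deriv (f' := fun x => 1 + h * deriv θ x)
      (fun x => by linarith [hpos x]) hd hcd
  refine ⟨e, ⟨hmono, hcd, hsd, fun x => ?_, fun x => ?_, ?_, ?_⟩, hex, hde⟩
  · rw [hde]
    linarith [(abs_le.1 (habs x)).2]
  · have h1 := (hd (e.symm x)).comp x (hsd.differentiable (by simp) x).hasDerivAt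
    have h2 : (fun x => x + h * θ x) ∘ e.symm = id := by
      ext y
      exact e.apply_symm_apply y
    rw [h2] at h1
    have h3 : (1 + h * deriv θ (e.symm x)) * deriv e.symm x = 1 :=
      h1.unique (hasDerivAt_id x)
    have h4 := hpos (e.symm x)
    nlinarith
  · rw [hex, h0]
    ring
  · rw [hex, hL]
    ring

/-! ### First order expansion of the stretched energy -/

namespace Laminate

variable {D : Laminate}

theorem measurable_layered (D : Laminate) (a b : ℝ) (n : ℕ) : Measurable (D.layered a b n) := by
  unfold layered
  exact Measurable.ite (measurableSet_lt (by fun_prop) measurable_const) measurable_const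
    measurable_const

theorem abs_layered_le (D : Laminate) (a b : ℝ) (n : ℕ) (x : ℝ) :
    |D.layered a b n x| ≤ |a| + |b| := by
  unfold layered
  split_ifs
  · linarith [abs_nonneg b]
  · linarith [abs_nonneg a]

theorem integrable_mul_sq {l : ℝ} {m : ℝ → ℝ} {B : ℝ} (hm : Measurable m) (hB : ∀ x, |m x| ≤ B)
    {u : ℝ × ℝ → ℝ} (hu : MemLp u 2 (volume.restrict (D.cracked l))) :
    Integrable (fun x => m x.1 * u x ^ 2) (volume.restrict (D.cracked l)) :=
  hu.integrable_sq.bdd_mul (c := B) (hm.comp measurable_fst).aestronglyMeasurable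
    (ae_of_all _ fun x => hB x.1)

/-- Young's inequality for (a + b)(a − b), with (a − b)²/2 rewritten by the parallelogram identity
as the defect of the midpoint. -/
theorem abs_sq_sub_sq_le (a b : ℝ) {κ : ℝ} (hκ : 0 < κ) :
    |a ^ 2 - b ^ 2| ≤ κ * (a ^ 2 + b ^ 2) + κ⁻¹ * (a ^ 2 + b ^ 2 - 2 * ((a + b) / 2) ^ 2) := by
  have h1 : κ * κ⁻¹ = 1 := mul_inv_cancel₀ hκ.ne'
  have h2 : 0 < κ⁻¹ := inv_pos.2 hκ
  have h3 := mul_nonneg hκ.le (sq_nonneg (a - b))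
  rw [abs_le]
  constructor
  · have := mul_nonneg h2.le (sq_nonneg (κ * (a + b) + (a - b)))
    have e : κ⁻¹ * (κ * (a + b) + (a - b)) ^ 2 =
        κ * (a + b) ^ 2 + 2 * (a ^ 2 - b ^ 2) + κ⁻¹ * (a - b) ^ 2 := by
      field_simp
      ring
    rw [e] at this
    linear_combination this / 2 + h3 / 2
  · have := mul_nonneg h2.le (sq_nonneg (κ * (a + b) - (a - b)))
    have e : κ⁻¹ * (κ * (a + b) - (a - b)) ^ 2 =
        κ * (a + b) ^ 2 - 2 * (a ^ 2 - b ^ 2) + κ⁻¹ * (a - b) ^ 2 := by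
      field_simp
      ring
    rw [e] at this
    linear_combination this / 2 + h3 / 2

theorem abs_half_integral_expansion_le {α : Type*} [MeasurableSpace α] {μ : Measure α}
    {f f₀ β : α → ℝ} (hf : Integrable f μ) (hf₀ : Integrable f₀ μ) (hβ : Integrable β μ) {c h : ℝ}
    (H : ∀ x, |f x - f₀ x - h * β x| ≤ c * f₀ x) :
    |1 / 2 * ∫ x, f x ∂μ - 1 / 2 * ∫ x, f₀ x ∂μ - h * (1 / 2 * ∫ x, β x ∂μ)| ≤
      c * (1 / 2 * ∫ x, f₀ x ∂μ) := by
  have h1 : ∫ x, f x - f₀ x - h * β x ∂μ =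
      ∫ x, f x ∂μ - ∫ x, f₀ x ∂μ - h * ∫ x, β x ∂μ := by
    rw [integral_sub (f := fun x => f x - f₀ x) (hf.sub hf₀) (hβ.const_mul h),
      integral_sub hf hf₀, integral_const_mul]
  have h2 := norm_integral_le_of_norm_le (f := fun x => f x - f₀ x - h * β x)
    (hf₀.const_mul c) (ae_of_all _ H)
  rw [h1, integral_const_mul, Real.norm_eq_abs, abs_le] at h2
  rw [abs_le]
  constructor <;> linarith [h2.1, h2.2]

theorem abs_half_integral_sub_le {α : Type*} [MeasurableSpace α] {μ : Measure α}
    {β β' f f' r : α → ℝ} (hβ : Integrable β μ) (hβ' : Integrable β' μ) (hf : Integrable f μ)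
    (hf' : Integrable f' μ) (hr : Integrable r μ) {M κ κ' : ℝ}
    (H : ∀ x, |β x - β' x| ≤ M * (κ * (f x + f' x) + κ' * (f x + f' x - 2 * r x))) :
    |1 / 2 * ∫ x, β x ∂μ - 1 / 2 * ∫ x, β' x ∂μ| ≤
      M * (κ * (1 / 2 * ∫ x, f x ∂μ + 1 / 2 * ∫ x, f' x ∂μ) +
        κ' * (1 / 2 * ∫ x, f x ∂μ + 1 / 2 * ∫ x, f' x ∂μ - 2 * (1 / 2 * ∫ x, r x ∂μ))) := by
  have i1 : Integrable (fun x => f x + f' x) μ := hf.add hf'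
  have i2 : Integrable (fun x => f x + f' x - 2 * r x) μ := i1.sub (hr.const_mul 2)
  have i3 : Integrable (fun x => M * (κ * (f x + f' x) + κ' * (f x + f' x - 2 * r x))) μ :=
    ((i1.const_mul κ).add (i2.const_mul κ')).const_mul M
  have h2 := norm_integral_le_of_norm_le (f := fun x => β x - β' x) i3 (ae_of_all _ H)
  rw [integral_const_mul, integral_add (i1.const_mul κ) (i2.const_mul κ'), integral_const_mul,
    integral_const_mul, integral_sub i1 (hr.const_mul 2), integral_const_mul, integral_add hf hf',
    integral_sub hβ hβ', Real.norm_eq_abs, abs_le] at h2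
  rw [abs_le]
  constructor <;> linarith [h2.1, h2.2]

/-- The derivative at `w = 1`, in the direction `m`, of the stretched energy. -/
def stretchedEnergyDeriv (D : Laminate) (m : ℝ → ℝ) (n : ℕ) (l : ℝ) (p : ℝ × ℝ → ℝ × ℝ) : ℝ :=
  1 / 2 * ∫ x in D.cracked l,
    (D.layered D.μA₂ D.μB₂ n x.1 * (p x).2 ^ 2 * m x.1
      - D.layered D.μA₁ D.μB₁ n x.1 * (p x).1 ^ 2 * m x.1)

section expansion

variable {M : ℝ} {m : ℝ → ℝ} {n : ℕ} {l : ℝ} {g : ℝ × ℝ → ℝ}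

theorem integrable_stretched {w : ℝ → ℝ} (hw : Measurable w) (hw1 : ∀ x, 1 / 2 ≤ w x)
    (hw2 : ∀ x, w x ≤ 2) {p : ℝ × ℝ → ℝ × ℝ} (hp : p ∈ D.admissibleGradients g l) :
    Integrable (fun x => D.layered D.μA₁ D.μB₁ n x.1 * (p x).1 ^ 2 / w x.1 +
      D.layered D.μA₂ D.μB₂ n x.1 * (p x).2 ^ 2 * w x.1) (volume.restrict (D.cracked l)) := by
  obtain ⟨u, hu, -⟩ := hp
  have h1 := integrable_mul_sq (m := fun x => D.layered D.μA₁ D.μB₁ n x / w x)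
    (B := (|D.μA₁| + |D.μB₁|) * 2)
    ((D.measurable_layered _ _ _).div hw) (fun x => by
      have := hw1 x
      rw [abs_div, div_eq_mul_inv]
      refine mul_le_mul (D.abs_layered_le _ _ _ _) ?_ (by positivity) (by positivity)
      rw [abs_of_pos (by linarith), inv_le_comm₀ (by linarith) (by norm_num)]
      linarith) hu.memLp_fst
  have h2 := integrable_mul_sq (m := fun x => D.layered D.μA₂ D.μB₂ n x * w x)
    (B := (|D.μA₂| + |D.μB₂|) * 2)
    ((D.measurable_layered _ _ _).mul hw) (fun x => by
      have := hw1 x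
      rw [abs_mul]
      refine mul_le_mul (D.abs_layered_le _ _ _ _) ?_ (by positivity) (by positivity)
      rw [abs_of_pos (by linarith)]
      exact hw2 x) hu.memLp_snd
  refine (h1.add h2).congr (ae_of_all _ fun x => ?_)
  simp only [Pi.add_apply]
  ring

theorem integrable_stretchedDeriv (hm : Measurable m) (hM : ∀ x, |m x| ≤ M)
    {p : ℝ × ℝ → ℝ × ℝ} (hp : p ∈ D.admissibleGradients g l) :
    Integrable (fun x => D.layered D.μA₂ D.μB₂ n x.1 * (p x).2 ^ 2 * m x.1
      - D.layered D.μA₁ D.μB₁ n x.1 * (p x).1 ^ 2 * m x.1) (volume.restrict (D.cracked l)) := by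
  obtain ⟨u, hu, -⟩ := hp
  have key : ∀ a b x, |D.layered a b n x * m x| ≤ (|a| + |b|) * M := fun a b x => by
    rw [abs_mul]
    exact mul_le_mul (D.abs_layered_le _ _ _ _) (hM x) (abs_nonneg _) (by positivity)
  have h1 := integrable_mul_sq ((D.measurable_layered D.μA₂ D.μB₂ n).mul hm) (key _ _)
    hu.memLp_snd
  have h2 := integrable_mul_sq ((D.measurable_layered D.μA₁ D.μB₁ n).mul hm) (key _ _)
    hu.memLp_fst
  refine (h1.sub h2).congr (ae_of_all _ fun x => ?_)
  simp only [Pi.sub_apply, Pi.mul_apply]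
  ring

theorem stretchedEnergy_nonneg {w : ℝ → ℝ} (hw : ∀ x, 0 ≤ w x) (p : ℝ × ℝ → ℝ × ℝ) :
    0 ≤ D.stretchedEnergy w n l p := by
  refine mul_nonneg (by norm_num) (integral_nonneg fun x => ?_)
  have h1 := (layered_pos (D := D) D.μA₁_pos D.μB₁_pos n x.1).le
  have h2 := (layered_pos (D := D) D.μA₂_pos D.μB₂_pos n x.1).le
  have := hw x.1
  simp only [Pi.zero_apply]
  positivity

/-- The weight enters linearly in the vertical part, so only 1/(1+s) has a remainder, s²/(1+s) with
s = h m; it is at most 2s² since s ≥ −1/2. -/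
theorem abs_stretchedEnergy_sub_le (hm : Measurable m) (hM : ∀ x, |m x| ≤ M) {h : ℝ}
    (hh : |h| * M ≤ 1 / 2) {p : ℝ × ℝ → ℝ × ℝ} (hp : p ∈ D.admissibleGradients g l) :
    |D.stretchedEnergy (fun x => 1 + h * m x) n l p - D.stretchedEnergy (fun x => 1 + 0 * m x) n l p
      - h * D.stretchedEnergyDeriv m n l p| ≤
      2 * M ^ 2 * h ^ 2 * D.stretchedEnergy (fun x => 1 + 0 * m x) n l p := by
  have habs : ∀ x, |h * m x| ≤ 1 / 2 := fun x => by
    rw [abs_mul]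
    exact (mul_le_mul_of_nonneg_left (hM x) (abs_nonneg h)).trans hh
  have i1 := integrable_stretched (n := n) (w := fun x => 1 + h * m x)
    (measurable_const.add (hm.const_mul h))
    (fun x => by linarith [(abs_le.1 (habs x)).1]) (fun x => by linarith [(abs_le.1 (habs x)).2]) hp
  have i0 := integrable_stretched (n := n) (w := fun x => 1 + 0 * m x)
    (measurable_const.add (hm.const_mul 0)) (fun x => by norm_num) (fun x => by norm_num) hp
  have i2 := integrable_stretchedDeriv (n := n) hm hM hp
  refine abs_half_integral_expansion_le i1 i0 i2 fun x => ?_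
  have h1 := (layered_pos (D := D) D.μA₁_pos D.μB₁_pos n x.1).le
  have h2 := (layered_pos (D := D) D.μA₂_pos D.μB₂_pos n x.1).le
  set a := D.layered D.μA₁ D.μB₁ n x.1
  set b := D.layered D.μA₂ D.μB₂ n x.1
  have hs := (abs_le.1 (habs x.1)).1
  have hs2 : (h * m x.1) ^ 2 ≤ M ^ 2 * h ^ 2 := by
    rw [mul_pow, mul_comm]
    exact mul_le_mul_of_nonneg_right (sq_le_sq' (abs_le.1 (hM _)).1 (abs_le.1 (hM _)).2)
      (sq_nonneg h)
  set s := h * m x.1 with hsdef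
  have hs1 : 0 < 1 + s := by linarith
  have e1 : a * (p x).1 ^ 2 / (1 + s) + b * (p x).2 ^ 2 * (1 + s) -
      (a * (p x).1 ^ 2 / (1 + 0 * m x.1) + b * (p x).2 ^ 2 * (1 + 0 * m x.1)) -
      h * (b * (p x).2 ^ 2 * m x.1 - a * (p x).1 ^ 2 * m x.1) =
      a * (p x).1 ^ 2 * (s ^ 2 / (1 + s)) := by
    rw [hsdef] at hs1 ⊢
    field_simp
    ring
  rw [e1, abs_of_nonneg (by positivity)]
  have e2 : s ^ 2 / (1 + s) ≤ 2 * M ^ 2 * h ^ 2 := by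
    rw [div_le_iff₀ hs1]
    nlinarith [mul_nonneg (sq_nonneg M) (sq_nonneg h)]
  have e3 : 0 ≤ 2 * M ^ 2 * h ^ 2 * (b * (p x).2 ^ 2) := by positivity
  have e4 := mul_le_mul_of_nonneg_left e2 (by positivity : 0 ≤ a * (p x).1 ^ 2)
  simp only [zero_mul, add_zero, div_one, mul_one]
  linarith

theorem abs_stretchedEnergyDeriv_sub_le (hm : Measurable m) (hM : ∀ x, |m x| ≤ M)
    {p q : ℝ × ℝ → ℝ × ℝ} (hp : p ∈ D.admissibleGradients g l)
    (hq : q ∈ D.admissibleGradients g l) {κ : ℝ} (hκ : 0 < κ) :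
    |D.stretchedEnergyDeriv m n l p - D.stretchedEnergyDeriv m n l q| ≤
      M * (κ * (D.stretchedEnergy (fun x => 1 + 0 * m x) n l p
          + D.stretchedEnergy (fun x => 1 + 0 * m x) n l q)
        + κ⁻¹ * (D.stretchedEnergy (fun x => 1 + 0 * m x) n l p
          + D.stretchedEnergy (fun x => 1 + 0 * m x) n l q
          - 2 * D.stretchedEnergy (fun x => 1 + 0 * m x) n l
            (fun x => (((p x).1 + (q x).1) / 2, ((p x).2 + (q x).2) / 2)))) := by
  have hM0 : 0 ≤ M := (abs_nonneg _).trans (hM 0)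
  have int : ∀ {r : ℝ × ℝ → ℝ × ℝ}, r ∈ D.admissibleGradients g l → _ := fun hr =>
    integrable_stretched (n := n) (w := fun x => 1 + 0 * m x)
    (measurable_const.add (hm.const_mul 0)) (fun x => by norm_num) (fun x => by norm_num) hr
  have ip := int hp
  have iq := int hq
  have ir := int (admissibleGradients_midpoint hp hq)
  have jp := integrable_stretchedDeriv (n := n) hm hM hp
  have jq := integrable_stretchedDeriv (n := n) hm hM hq
  refine abs_half_integral_sub_le jp jq ip iq ir fun x => ?_
  have h1 := (layered_pos (D := D) D.μA₁_pos D.μB₁_pos n x.1).le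
  have h2 := (layered_pos (D := D) D.μA₂_pos D.μB₂_pos n x.1).le
  set a := D.layered D.μA₁ D.μB₁ n x.1
  set b := D.layered D.μA₂ D.μB₂ n x.1
  have k1 := mul_le_mul_of_nonneg_left (abs_sq_sub_sq_le (p x).1 (q x).1 hκ) h1
  have k2 := mul_le_mul_of_nonneg_left (abs_sq_sub_sq_le (p x).2 (q x).2 hκ) h2
  simp only [zero_mul, add_zero, div_one, mul_one]
  have e : b * (p x).2 ^ 2 * m x.1 - a * (p x).1 ^ 2 * m x.1 -
      (b * (q x).2 ^ 2 * m x.1 - a * (q x).1 ^ 2 * m x.1) =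
      m x.1 * (b * ((p x).2 ^ 2 - (q x).2 ^ 2) - a * ((p x).1 ^ 2 - (q x).1 ^ 2)) := by ring
  rw [e, abs_mul]
  refine mul_le_mul (hM _) ?_ (abs_nonneg _) hM0
  refine (abs_sub _ _).trans ?_
  rw [abs_mul, abs_mul, abs_of_nonneg h1, abs_of_nonneg h2]
  linarith

end expansion

/-! ### Local constancy of the coefficients and semicontinuity of the derivative -/

theorem eventually_layered_eq_right (D : Laminate) (n : ℕ) (l : ℝ) :
    ∀ᶠ x in 𝓝[>] l, ∀ a b, D.layered a b n x = D.layered a b n l := by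
  have hL : 0 < D.L := D.L₀_pos.trans D.L₀_lt
  have hc : Continuous fun x : ℝ => n * x / D.L := by fun_prop
  have h1 : ∀ᶠ x in 𝓝[>] l, n * x / D.L < ⌊n * l / D.L⌋ + 1 :=
    nhdsWithin_le_nhds ((hc.tendsto l).eventually (gt_mem_nhds (Int.lt_floor_add_one _)))
  have h2 : ∀ᶠ x in 𝓝[>] l, Int.fract (n * l / D.L) < D.lam →
      n * x / D.L - ⌊n * l / D.L⌋ < D.lam := by
    by_cases h : Int.fract (n * l / D.L) < D.lam
    · have := nhdsWithin_le_nhds (s := Ioi l) (((hc.sub continuous_const).tendsto l).eventually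
        (gt_mem_nhds h))
      filter_upwards [this] with x hx _ using hx
    · exact Eventually.of_forall fun x hx => absurd hx h
  filter_upwards [h1, h2, self_mem_nhdsWithin] with x h1 h2 hx a b
  have hx : l < x := hx
  have hle : n * l / D.L ≤ n * x / D.L := by gcongr
  have hf : ⌊n * x / D.L⌋ = ⌊n * l / D.L⌋ :=
    Int.floor_eq_iff.2 ⟨(Int.floor_le _).trans hle, h1⟩
  have : Int.fract (n * x / D.L) < D.lam ↔ Int.fract (n * l / D.L) < D.lam := by
    refine ⟨fun h => ?_, fun h => ?_⟩
    · refine lt_of_le_of_lt ?_ h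
      rw [← Int.self_sub_floor, ← Int.self_sub_floor, hf]
      linarith
    · rw [← Int.self_sub_floor, hf]
      exact h2 h
  simp only [layered, this]

theorem eventually_layered_eq {n : ℕ} (hn : 0 < n) {l : ℝ} (hl : l ∈ Ioo 0 D.L)
    (hli : l ∉ D.interfaces n) : ∀ᶠ x in 𝓝 l, ∀ a b, D.layered a b n x = D.layered a b n l := by
  have hL : 0 < D.L := D.L₀_pos.trans D.L₀_lt
  have hn' : (0 : ℝ) < n := Nat.cast_pos.2 hn
  have hc : Continuous fun x : ℝ => n * x / D.L := by fun_prop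
  have hz0 : 0 < n * l / D.L := div_pos (mul_pos hn' hl.1) hL
  have hzn : n * l / D.L < n := by
    rw [div_lt_iff₀ hL]
    exact mul_lt_mul_of_pos_left hl.2 hn'
  obtain ⟨k, hk⟩ : ∃ k : ℕ, ⌊n * l / D.L⌋ = k :=
    Int.eq_ofNat_of_zero_le (Int.floor_nonneg.2 hz0.le)
  have hkn : k < n := by
    have : (k : ℝ) ≤ n * l / D.L := by
      have := Int.floor_le (n * l / D.L)
      rwa [hk] at this
    exact_mod_cast this.trans_lt hzn
  have hkl : (k : ℝ) < n * l / D.L := by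
    refine lt_of_le_of_ne ?_ fun h => hli (Or.inl ⟨k, hkn.le, ?_⟩)
    · have := Int.floor_le (n * l / D.L)
      rwa [hk] at this
    · rw [h]
      field_simp
  have hlk : n * l / D.L < k + 1 := by
    have := Int.lt_floor_add_one (n * l / D.L)
    rwa [hk] at this
  have hfr : n * l / D.L - k ≠ D.lam := fun h => hli (Or.inr ⟨k, hkn, by
    rw [← h]
    field_simp
    ring⟩)
  have h3 : ∀ᶠ x in 𝓝 l, (n * x / D.L - k < D.lam ↔ n * l / D.L - k < D.lam) := by
    rcases hfr.lt_or_gt with h | h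
    · filter_upwards [((hc.sub continuous_const).tendsto l).eventually (gt_mem_nhds h)] with x hx
      exact ⟨fun _ => h, fun _ => hx⟩
    · filter_upwards [((hc.sub continuous_const).tendsto l).eventually (lt_mem_nhds h)] with x hx
      exact ⟨fun h' => absurd h' (not_lt.2 hx.le), fun h' => absurd h' (not_lt.2 h.le)⟩
  filter_upwards [(hc.tendsto l).eventually (gt_mem_nhds hlk),
    (hc.tendsto l).eventually (lt_mem_nhds hkl), h3] with x h1 h2 h3 a b
  have hf : ⌊n * x / D.L⌋ = k := Int.floor_eq_iff.2 ⟨by exact_mod_cast h2.le, by exact_mod_cast h1⟩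
  simp only [layered, ← Int.self_sub_floor, hf, hk, Int.cast_natCast, h3]

theorem finite_interfaces (D : Laminate) (n : ℕ) : (D.interfaces n).Finite := by
  have h1 : {l : ℝ | ∃ k : ℕ, k ≤ n ∧ l = k * (D.L / n)}.Finite :=
    ((finite_Iic n).image fun k : ℕ => (k : ℝ) * (D.L / n)).subset
      fun l ⟨k, hk, h⟩ => ⟨k, hk, h.symm⟩
  have h2 : {l : ℝ | ∃ k : ℕ, k < n ∧ l = (k + D.lam) * (D.L / n)}.Finite :=
    ((finite_Iio n).image fun k : ℕ => ((k : ℝ) + D.lam) * (D.L / n)).subset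
      fun l ⟨k, hk, h⟩ => ⟨k, hk, h.symm⟩
  exact h1.union h2

theorem eventually_lt_deriv_condensedEnergy (g : ℝ × ℝ → ℝ) {n : ℕ} (hn : 0 < n) {l : ℝ}
    (hl : l ∈ Ioo 0 D.L) (hli : l ∉ D.interfaces n) {c : ℝ}
    (hc : c < deriv (D.condensedEnergy g n) l) :
    ∀ᶠ y in 𝓝 l, c < deriv (D.condensedEnergy g n) y := by
  obtain ⟨δ, hδ, hball⟩ : ∃ δ > 0, ∀ x, |x - l| ≤ 2 * δ → x ∈ Ioo 0 D.L ∧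
      ∀ a b, D.layered a b n x = D.layered a b n l := by
    obtain ⟨r, hr, h⟩ := Metric.eventually_nhds_iff.1
      ((isOpen_Ioo.eventually_mem hl).and (eventually_layered_eq hn hl hli))
    exact ⟨r / 3, by positivity, fun x hx => h (by rw [Real.dist_eq]; linarith)⟩
  -- θ is 1 on the δ-ball, so one family of stretches translates every tip y near l by exactly h; it
  -- vanishes outside the 2δ-ball, which lies in a single layer and away from the lateral sides. The
  -- constants are therefore uniform in y.
  let θ : ContDiffBump l := ⟨δ, 2 * δ, hδ, by linarith⟩
  have hθ : ContDiff ℝ ∞ θ := θ.contDiff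
  have hθout : ∀ x, 2 * δ ≤ |x - l| → θ x = 0 := fun x hx => θ.zero_of_le_dist hx
  have hθ0 : θ 0 = 0 := hθout _ (by
    by_contra! h
    exact lt_irrefl _ (hball 0 h.le).1.1)
  have hθL : θ D.L = 0 := hθout _ (by
    by_contra! h
    exact lt_irrefl _ (hball D.L h.le).1.2)
  have hθ1 : ∀ x, |θ x| ≤ 1 := fun x => by
    rw [abs_of_nonneg θ.nonneg]
    exact θ.le_one
  obtain ⟨M, hM⟩ : ∃ M, ∀ x, |deriv θ x| ≤ M :=
    θ.hasCompactSupport.deriv.exists_bound_of_continuous (hθ.continuous_deriv (by simp))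
  have hM0 : 0 ≤ M := (abs_nonneg _).trans (hM 0)
  have hmeas : Measurable (deriv θ) := measurable_deriv _
  set h₀ : ℝ := 1 / (2 * (M + 1)) with hh₀def
  have hh₀ : 0 < h₀ := by positivity
  have hhM : ∀ h, |h| ≤ h₀ → |h| * M ≤ 1 / 2 := fun h hh => by
    refine (mul_le_mul_of_nonneg_right hh hM0).trans ?_
    rw [hh₀def, div_mul_eq_mul_div, div_le_iff₀ (by positivity)]
    linarith
  have key : ∀ y, |y - l| < δ → ∀ h, |h| ≤ h₀ → D.condensedEnergy g n (y + h) =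
      sInf (D.stretchedEnergy (fun x => 1 + h * deriv θ x) n y '' D.admissibleGradients g y) := by
    intro y hy h hh
    obtain ⟨e, he, hex, hde⟩ := exists_isStretch_perturbation hθ hθ0 hθL hθ1 hM (hhM h hh)
    have h1 : e y = y + h := by
      rw [hex, θ.one_of_mem_closedBall (by rw [mem_closedBall_iff_norm, Real.norm_eq_abs]; exact hy.le)]
      ring
    rw [← hde, ← h1]
    refine condensedEnergy_stretch he (fun a b x => ?_) g y
    -- The stretch fixes the end points of the 2δ-ball, hence maps it into itself, where the
    -- coefficients are constant.
    by_cases hx : |x - l| ≤ 2 * δ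
    · have h2 : e (l + 2 * δ) = l + 2 * δ := by
        rw [hex, hθout _ (by rw [add_sub_cancel_left, abs_of_pos (by linarith)])]
        ring
      have h3 : e (l - 2 * δ) = l - 2 * δ := by
        rw [hex, hθout _ (by rw [sub_sub_cancel_left, abs_neg, abs_of_pos (by linarith)])]
        ring
      have h4 : e x ≤ e (l + 2 * δ) := he.strictMono.monotone (by linarith [(abs_le.1 hx).2])
      have h5 : e (l - 2 * δ) ≤ e x := he.strictMono.monotone (by linarith [(abs_le.1 hx).1])
      rw [(hball x hx).2, (hball (e x) (abs_le.2 ⟨by linarith, by linarith⟩)).2]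
    · rw [hex, hθout x (not_le.1 hx).le, mul_zero, add_zero]
  have main : ∀ y, |y - l| < δ → DifferentiableAt ℝ (D.condensedEnergy g n) y ∧
      ∀ h, |h| ≤ h₀ → D.condensedEnergy g n (y + h) ≤ D.condensedEnergy g n y +
        h * deriv (D.condensedEnergy g n) y + (2 * M ^ 2 + M) * h ^ 2 * D.condensedEnergy g n y := by
    intro y hy
    -- In the constant, 2M² comes from the remainder of the expansion and M from the comparison of
    -- first order terms.
    obtain ⟨d, hd, hle⟩ := exists_hasDerivAt_sInf (P := D.admissibleGradients g y)
      (F := fun h => D.stretchedEnergy (fun x => 1 + h * deriv θ x) n y)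
      (b := D.stretchedEnergyDeriv (deriv θ) n y) (C := 2 * M ^ 2 + M) hh₀ (by positivity)
      (fun h hh p _ => stretchedEnergy_nonneg (fun x => by
        have := (mul_le_mul_of_nonneg_left (hM x) (abs_nonneg h)).trans (hhM h hh)
        rw [← abs_mul] at this
        linarith [(abs_le.1 this).1]) p)
      (fun h hh p hp => (abs_stretchedEnergy_sub_le hmeas hM (hhM h hh) hp).trans (by
        refine mul_le_mul_of_nonneg_right (mul_le_mul_of_nonneg_right (by linarith) (sq_nonneg h))
          (stretchedEnergy_nonneg (fun x => by norm_num) p)))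
      (fun p hp q hq κ hκ => by
        have h1 := abs_stretchedEnergyDeriv_sub_le (n := n) hmeas hM hp hq hκ
        have hbd : BddBelow (D.stretchedEnergy (fun x => 1 + 0 * deriv θ x) n y ''
            D.admissibleGradients g y) := ⟨0, by
          rintro _ ⟨r, -, rfl⟩
          exact stretchedEnergy_nonneg (fun x => by norm_num) r⟩
        have h2 : sInf (D.stretchedEnergy (fun x => 1 + 0 * deriv θ x) n y ''
            D.admissibleGradients g y) ≤ _ :=
          csInf_le hbd ⟨_, admissibleGradients_midpoint hp hq, rfl⟩
        have h3 := mul_le_mul_of_nonneg_left h2 (inv_pos.2 hκ).le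
        have h4 : ∀ r ∈ D.admissibleGradients g y,
            sInf (D.stretchedEnergy (fun x => 1 + 0 * deriv θ x) n y ''
            D.admissibleGradients g y) ≤ D.stretchedEnergy (fun x => 1 + 0 * deriv θ x) n y r :=
          fun r hr => csInf_le hbd ⟨r, hr, rfl⟩
        have h5 : ∀ r, 0 ≤ D.stretchedEnergy (fun x => 1 + 0 * deriv θ x) n y r :=
          fun r => stretchedEnergy_nonneg (fun x => by norm_num) r
        have arith : ∀ a X X' : ℝ, a ≤ M * X' → X' ≤ X → 0 ≤ X → a ≤ (2 * M ^ 2 + M) * X :=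
          fun a X X' u v w => by
            linarith [mul_le_mul_of_nonneg_left v hM0, mul_nonneg (sq_nonneg M) w]
        refine arith _ _ _ h1 ?_ ?_
        · linarith
        · exact add_nonneg (mul_nonneg hκ.le (add_nonneg (h5 p) (h5 q)))
            (mul_nonneg (inv_pos.2 hκ).le (by linarith [h4 p hp, h4 q hq])))
    have hd' : HasDerivAt (fun h => D.condensedEnergy g n (y + h)) d 0 := by
      refine hd.congr_of_eventuallyEq ?_
      filter_upwards [(continuous_abs.tendsto' (0 : ℝ) 0 abs_zero).eventually (ge_mem_nhds hh₀)]
        with h hh using key y hy h hh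
    have hd'' : HasDerivAt (D.condensedEnergy g n) d y := by
      have h1 := HasDerivAt.comp_sub_const y y (f := fun h => D.condensedEnergy g n (y + h))
        (by simpa using hd')
      simpa using h1
    refine ⟨hd''.differentiableAt, fun h hh => ?_⟩
    have h0 := key y hy 0 (by simpa using hh₀.le)
    rw [add_zero] at h0
    rw [key y hy h hh, h0, hd''.deriv]
    exact hle h hh
  have hnear : ∀ᶠ y in 𝓝 l, |y - l| < δ := Metric.ball_mem_nhds l hδ
  exact eventually_lt_deriv_of_le_parabola hh₀ (hnear.mono fun y hy => (main y hy).1)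
    (hnear.mono fun y hy => (main y hy).2) hc

end Laminate

/-! ### Griffith's criterion and barriers for the crack tip -/

namespace Laminate

variable {D : Laminate}

theorem toughness_pos (D : Laminate) (n : ℕ) (l : ℝ) : 0 < D.toughness n l :=
  layered_pos D.gcA_pos D.gcB_pos n l

theorem ofReal_toughness_ne_zero (D : Laminate) (n : ℕ) (l : ℝ) :
    ENNReal.ofReal (D.toughness n l) ≠ 0 :=
  (ENNReal.ofReal_pos.2 (D.toughness_pos n l)).ne'

theorem releaseRatio_lt_inv_iff {g : ℝ × ℝ → ℝ} {n : ℕ} {l : ℝ} {a : ℝ≥0∞} :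
    D.releaseRatio g n l < a⁻¹ ↔
      D.energyRelease g n l < ENNReal.ofReal (D.toughness n l) / a := by
  rw [releaseRatio, ENNReal.div_lt_iff (Or.inl (D.ofReal_toughness_ne_zero n l))
    (Or.inl ENNReal.ofReal_ne_top), mul_comm, div_eq_mul_inv]

theorem energyRelease_of_notMem {g : ℝ × ℝ → ℝ} {n : ℕ} {l : ℝ} (hl : l ≠ D.L)
    (hli : l ∉ D.interfaces n) :
    D.energyRelease g n l = ENNReal.ofReal (-deriv (D.condensedEnergy g n) l) := by
  rw [energyRelease, if_neg hl, if_neg hli]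

/-- Off the interfaces the energy release is upper semicontinuous. -/
theorem eventually_energyRelease_lt {g : ℝ × ℝ → ℝ} {n : ℕ} (hn : 0 < n) {l : ℝ}
    (hl : l ∈ Ioo 0 D.L) (hli : l ∉ D.interfaces n) {a : ℝ≥0∞} (ha : D.energyRelease g n l < a) :
    ∀ᶠ y in 𝓝 l, D.energyRelease g n y < a := by
  rw [energyRelease_of_notMem hl.2.ne hli] at ha
  obtain ⟨r, -, hr, hra⟩ := ENNReal.lt_iff_exists_real_btwn.1 ha
  have hr' : -r < deriv (D.condensedEnergy g n) l := by
    by_contra! h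
    exact (ENNReal.ofReal_le_ofReal (by linarith)).not_gt hr
  filter_upwards [eventually_lt_deriv_condensedEnergy g hn hl hli hr', gt_mem_nhds hl.2,
    (D.finite_interfaces n).isClosed.isOpen_compl.mem_nhds hli] with y h1 h2 h3
  rw [energyRelease_of_notMem h2.ne h3]
  exact (ENNReal.ofReal_le_ofReal (by linarith)).trans_lt hra

namespace IsQuasiStaticEvolution

variable {T : ℝ} {f : ℝ → ℝ} {g : ℝ × ℝ → ℝ} {n : ℕ} {ℓ : ℝ → ℝ}

theorem exists_leftLimit (h : D.IsQuasiStaticEvolution T f g n ℓ) {t : ℝ} (ht : t ∈ Ioo 0 T) :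
    ∃ ℓm, Tendsto ℓ (𝓝[<] t) (𝓝 ℓm) ∧ ℓm ≤ ℓ t := by
  have hle : ∀ s ∈ Ioo 0 t, ℓ s ≤ ℓ t := fun s hs =>
    h.monotoneOn ⟨hs.1.le, hs.2.trans ht.2⟩ ⟨ht.1.le, ht.2⟩ hs.2.le
  have hbdd : BddAbove (ℓ '' Ioo 0 t) := ⟨ℓ t, by rintro _ ⟨s, hs, rfl⟩; exact hle s hs⟩
  have hne : (Ioo 0 t).Nonempty := nonempty_Ioo.2 ht.1
  refine ⟨_, MonotoneOn.tendsto_nhdsWithin_Ioo_left hne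
    (h.monotoneOn.mono fun s hs => ⟨hs.1.le, hs.2.trans ht.2⟩) hbdd, ?_⟩
  refine csSup_le (hne.image _) ?_
  rintro _ ⟨s, hs, rfl⟩
  exact hle s hs

theorem le_release_of_jump (h : D.IsQuasiStaticEvolution T f g n ℓ) {t : ℝ} (ht : t ∈ Ioo 0 T)
    {ℓm y : ℝ} (hℓm : Tendsto ℓ (𝓝[<] t) (𝓝 ℓm)) (hy : y ∈ Ico ℓm (ℓ t)) :
    ENNReal.ofReal (D.toughness n y) ≤ D.energyRelease (f t • g) n y := by
  refine h.unstable_jump t ⟨ht.1.le, ht.2⟩ (fun hc => ?_) ℓm hℓm y hy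
  have h1 : Tendsto ℓ (𝓝[<] t) (𝓝 (ℓ t)) := hc.mono_left <| nhdsWithin_le_of_mem <|
    mem_of_superset (Ioo_mem_nhdsLT ht.1) fun s hs => ⟨hs.1.le, hs.2.trans ht.2⟩
  exact (hy.1.trans_lt hy.2).ne (tendsto_nhds_unique hℓm h1)

/-- The crack tip does not cross a strip in which the release is smaller than the toughness. -/
theorem le_of_release_lt (h : D.IsQuasiStaticEvolution T f g n ℓ) {t l ε : ℝ} (ht : t ∈ Ico 0 T)
    (hl : D.L₀ ≤ l) (hε : 0 < ε)
    (H : ∀ τ ∈ Icc 0 t, ∀ y ∈ Ico l (l + ε),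
      D.energyRelease (f τ • g) n y < ENNReal.ofReal (D.toughness n y)) : ℓ t ≤ l := by
  by_contra! hlt
  -- The infimum s of the times past l is the crossing time. A jump past l at s is excluded by the
  -- release at l, so the tip sits at l at time s and enters the strip by right continuity.
  set S : Set ℝ := {τ | τ ∈ Icc 0 t ∧ l < ℓ τ} with hS
  have htS : t ∈ S := ⟨⟨ht.1, le_rfl⟩, hlt⟩
  have hSb : BddBelow S := ⟨0, fun τ hτ => hτ.1.1⟩
  set s := sInf S with hs
  have hs0 : 0 ≤ s := le_csInf ⟨t, htS⟩ fun τ hτ => hτ.1.1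
  have hst : s ≤ t := csInf_le hSb htS
  have hsT : s < T := hst.trans_lt ht.2
  have hbelow : ∀ τ, 0 ≤ τ → τ < s → ℓ τ ≤ l := fun τ h0 hτ => by
    by_contra! hc
    exact (csInf_le hSb ⟨⟨h0, hτ.le.trans hst⟩, hc⟩).not_gt hτ
  have habove : ∀ τ ∈ Ioc s t, l < ℓ τ := fun τ hτ => by
    obtain ⟨r, hr, hrτ⟩ := exists_lt_of_csInf_lt ⟨t, htS⟩ hτ.1
    exact hr.2.trans_le (h.monotoneOn ⟨hr.1.1, hr.1.2.trans_lt ht.2⟩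
      ⟨hs0.trans hτ.1.le, hτ.2.trans_lt ht.2⟩ hrτ.le)
  have hsl : ℓ s ≤ l := by
    by_contra! hc
    have hspos : 0 < s := by
      refine hs0.lt_of_ne fun h0 => ?_
      rw [← h0, h.initial] at hc
      exact hc.not_ge hl
    obtain ⟨ℓm, hℓm, -⟩ := h.exists_leftLimit ⟨hspos, hsT⟩
    have hml : ℓm ≤ l := by
      refine le_of_tendsto hℓm ?_
      filter_upwards [Ioo_mem_nhdsLT hspos] with τ hτ using hbelow τ hτ.1.le hτ.2
    exact (h.le_release_of_jump ⟨hspos, hsT⟩ hℓm ⟨hml, hc⟩).not_gt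
      (H s ⟨hs0, hst⟩ l ⟨le_rfl, by linarith⟩)
  have hs_lt : s < t := by
    refine hst.lt_of_ne fun h0 => ?_
    rw [h0] at hsl
    exact hsl.not_gt hlt
  have hlim : Tendsto ℓ (𝓝[>] s) (𝓝 (ℓ s)) :=
    (h.right_continuous s ⟨hs0, hsT⟩).mono_left (nhdsWithin_mono s Ioi_subset_Ici_self)
  have hls : ℓ s = l := by
    refine le_antisymm hsl (ge_of_tendsto hlim ?_)
    filter_upwards [Ioc_mem_nhdsGT hs_lt] with τ hτ using (habove τ hτ).le
  obtain ⟨t₁, ht₁, ht₁ε⟩ : ∃ t₁ ∈ Ioc s t, ℓ t₁ < l + ε := by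
    have h1 := hlim.eventually (gt_mem_nhds (by rw [hls]; linarith : ℓ s < l + ε))
    obtain ⟨t₁, h2, h3⟩ := (h1.and (Ioc_mem_nhdsGT hs_lt)).exists
    exact ⟨t₁, h3, h2⟩
  have ht₁T : t₁ < T := ht₁.2.trans_lt ht.2
  have hrange : ∀ τ ∈ Icc s t₁, ℓ τ ∈ Ico l (l + ε) := fun τ hτ => by
    have hτ' : τ ∈ Ico 0 T := ⟨hs0.trans hτ.1, hτ.2.trans_lt ht₁T⟩
    exact ⟨hls ▸ h.monotoneOn ⟨hs0, hsT⟩ hτ' hτ.1,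
      (h.monotoneOn hτ' ⟨hs0.trans ht₁.1.le, ht₁T⟩ hτ.2).trans_lt ht₁ε⟩
  -- On [s, t₁] the tip stays in the strip: a jump would start from a left limit in the strip, where
  -- release < toughness, so ℓ is continuous; with zero right derivative it is constant,
  -- contradicting ℓ t₁ > l.
  have hconst := constant_of_has_deriv_right_zero (f := ℓ) (a := s) (b := t₁)
    (fun τ hτ => by
      have hτ' : τ ∈ Ico 0 T := ⟨hs0.trans hτ.1, hτ.2.trans_lt ht₁T⟩
      rcases hτ.1.eq_or_lt with rfl | hsτ
      · exact (h.right_continuous s hτ').mono fun x hx => hx.1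
      have hτ0 : 0 < τ := hs0.trans_lt hsτ
      obtain ⟨ℓm, hℓm, hle⟩ := h.exists_leftLimit ⟨hτ0, hτ'.2⟩
      have hlm : l ≤ ℓm := by
        refine ge_of_tendsto hℓm ?_
        filter_upwards [Ioo_mem_nhdsLT hsτ] with r hr
        exact (hrange r ⟨hr.1.le, hr.2.le.trans hτ.2⟩).1
      rcases hle.eq_or_lt with rfl | hlt'
      · refine ContinuousAt.continuousWithinAt ?_
        refine continuousAt_iff_continuous_left'_right'.2 ⟨hℓm, ?_⟩
        exact (h.right_continuous τ hτ').mono Ioi_subset_Ici_self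
      · exact absurd (H τ ⟨hτ'.1, hτ.2.trans ht₁.2⟩ ℓm ⟨hlm, hlt'.trans (hrange τ hτ).2⟩)
          (h.le_release_of_jump ⟨hτ0, hτ'.2⟩ hℓm ⟨le_rfl, hlt'⟩).not_gt)
    (fun τ hτ => h.stationary τ ⟨hs0.trans hτ.1, hτ.2.trans ht₁T⟩
      (H τ ⟨hs0.trans hτ.1, hτ.2.le.trans ht₁.2⟩ _ (hrange τ ⟨hτ.1, hτ.2.le⟩)))
    t₁ ⟨ht₁.1.le, le_rfl⟩
  rw [hls] at hconst
  exact (habove t₁ ht₁).ne' hconst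

theorem le_of_releaseRatio_lt (h : D.IsQuasiStaticEvolution T f g n ℓ) (hn : 0 < n)
    (hf : MonotoneOn f (Icc 0 T)) (hf0 : f 0 = 0) {t l : ℝ} (ht : t ∈ Ico 0 T)
    (hl : l ∈ Icc D.L₀ D.L)
    (hr : D.releaseRatio g n l < (ENNReal.ofReal (f t ^ 2))⁻¹) : ℓ t ≤ l := by
  rw [releaseRatio_lt_inv_iff] at hr
  have hfsq : ∀ τ ∈ Icc 0 t, f τ ^ 2 ≤ f t ^ 2 := fun τ hτ => by
    have h1 : τ ∈ Icc 0 T := ⟨hτ.1, hτ.2.trans ht.2.le⟩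
    refine pow_le_pow_left₀ ?_ (hf h1 ⟨ht.1, ht.2.le⟩ hτ.2) 2
    rw [← hf0]
    exact hf ⟨le_rfl, ht.1.trans ht.2.le⟩ h1 hτ.1
  -- At l = L the release is 0 by convention and carries no information, but ℓ ≤ L always holds.
  rcases hl.2.eq_or_lt with rfl | hlL
  · exact (h.mapsTo ht).2
  have off : ∀ y ∈ Ico D.L₀ D.L, y ∉ D.interfaces n →
      D.energyRelease g n y < ENNReal.ofReal (D.toughness n y) / ENNReal.ofReal (f t ^ 2) →
      ℓ t ≤ y := by
    intro y hy hyi hyr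
    have hy' : y ∈ Ioo 0 D.L := ⟨D.L₀_pos.trans_le hy.1, hy.2⟩
    obtain ⟨ε, hε, hball⟩ := Metric.eventually_nhds_iff.1
      ((eventually_energyRelease_lt hn hy' hyi hyr).and (eventually_layered_eq hn hy' hyi))
    refine h.le_of_release_lt ht hy.1 hε fun τ hτ z hz => ?_
    obtain ⟨h1, h2⟩ := hball (y := z) (by
      rw [Real.dist_eq, abs_of_nonneg (by linarith [hz.1])]
      linarith [hz.2])
    have h3 : D.toughness n z = D.toughness n y := h2 _ _
    rw [energyRelease_smul, h3]
    refine lt_of_le_of_lt ?_ (ENNReal.mul_lt_of_lt_div h1)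
    rw [mul_comm]
    exact mul_le_mul' le_rfl (ENNReal.ofReal_le_ofReal (hfsq τ hτ))
  by_cases hli : l ∈ D.interfaces n
  -- Just to the right of an interface the toughness is unchanged, and the lower limit gives points
  -- below any c > l, off the interfaces, that are barriers.
  · refine le_of_forall_gt_imp_ge_of_dense fun c hc => ?_
    rw [energyRelease, if_neg hlL.ne, if_pos hli] at hr
    have hfreq := frequently_lt_of_liminf_lt (by isBoundedDefault) hr
    have hcompl : ∀ᶠ s in 𝓝[>] l, s ∈ (D.interfaces n \ {l})ᶜ := nhdsWithin_le_nhds <|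
      ((D.finite_interfaces n).sdiff).isClosed.isOpen_compl.mem_nhds (by simp)
    obtain ⟨s, hs1, hs2, hs3, hs4, hs5⟩ := (hfreq.and_eventually
      ((D.eventually_layered_eq_right n l).and (hcompl.and
        (inter_mem (Ioo_mem_nhdsGT hc) (Ioo_mem_nhdsGT hlL))))).exists
    have hs6 : s ∉ D.interfaces n := fun h' => hs3 ⟨h', hs4.1.ne'⟩
    refine (off s ⟨hl.1.trans hs4.1.le, hs5.2⟩ hs6 ?_).trans hs4.2.le
    rw [energyRelease_of_notMem hs5.2.ne hs6]
    have h3 : D.toughness n s = D.toughness n l := hs2 _ _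
    rwa [h3]
  · exact off l ⟨hl.1, hlL⟩ hli hr

theorem releaseRatio_le (h : D.IsQuasiStaticEvolution T f g n ℓ) {t : ℝ} (ht : t ∈ Ico 0 T) :
    D.releaseRatio g n (ℓ t) ≤ (ENNReal.ofReal (f t ^ 2))⁻¹ := by
  have h1 := h.stable t ht
  rw [energyRelease_smul, mul_comm, ← ENNReal.le_div_iff_mul_le (Or.inr
    (D.ofReal_toughness_ne_zero n _)) (Or.inr ENNReal.ofReal_ne_top)] at h1
  rw [releaseRatio, ENNReal.div_le_iff (D.ofReal_toughness_ne_zero n _) ENNReal.ofReal_ne_top,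
    mul_comm, ← div_eq_mul_inv]
  exact h1

end IsQuasiStaticEvolution

end Laminate

end

/-! ### Passage to the limit -/

theorem proposition1p9 (D : Laminate) (T : ℝ) (hT : 0 < T)
    (f : ℝ → ℝ) (hf : ContDiffOn ℝ 1 f (Icc 0 T)) (hf0 : f 0 = 0)
    (hf' : ∀ t ∈ Icc 0 T, 0 < derivWithin f (Icc 0 T) t)
    (g : ℝ × ℝ → ℝ) (hg : D.MemHHalf g)
    (ℓ : ℕ → ℝ → ℝ) (hℓ : ∀ n, 0 < n → D.IsQuasiStaticEvolution T f g n (ℓ n)) :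
    -- a subsequence converges pointwise in `[0,T)`
    (∃ σ : ℕ → ℕ, StrictMono σ ∧ ∃ ℓlim : ℝ → ℝ,
      ∀ t ∈ Ico 0 T, Tendsto (fun k => ℓ (σ k) t) atTop (𝓝 (ℓlim t))) ∧
    -- whenever a subsequence converges pointwise in `[0,T)`, the right limits of its limit are
    -- given by the formula below, in which `1 / f² (0) = ∞`
    (∀ σ : ℕ → ℕ, StrictMono σ → ∀ ℓlim : ℝ → ℝ,
      (∀ t ∈ Ico 0 T, Tendsto (fun k => ℓ (σ k) t) atTop (𝓝 (ℓlim t))) →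
      ∀ t ∈ Ico 0 T, Tendsto ℓlim (𝓝[>] t) (𝓝 (sInf {l | l ∈ Icc D.L₀ D.L ∧
        gammaLiminf (Icc D.L₀ D.L) (fun k => D.releaseRatio g (σ k)) l
          < (ENNReal.ofReal (f t ^ 2))⁻¹}))) := by
  have hfmono : StrictMonoOn f (Icc 0 T) :=
    strictMonoOn_of_deriv_pos (convex_Icc 0 T) hf.continuousOn fun t ht => by
      rw [interior_Icc] at ht
      rw [← derivWithin_of_mem_nhds (Icc_mem_nhds ht.1 ht.2)]
      exact hf' t ⟨ht.1.le, ht.2.le⟩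
  constructor
  · have hLL := D.L₀_lt.le
    -- Monotone extension to the whole line, as Helly's theorem is stated there; the shift to `n +
    -- 1` avoids the index 0, for which there is no evolution.
    let w : ℕ → ℝ → ℝ := fun n t => if t < 0 then D.L₀ else if t < T then ℓ (n + 1) t else D.L
    have hw : ∀ n t, w n t ∈ Icc D.L₀ D.L := fun n t => by
      simp only [w]
      split_ifs with h1 h2
      · exact ⟨le_rfl, hLL⟩
      · exact (hℓ _ n.succ_pos).mapsTo ⟨not_lt.1 h1, h2⟩
      · exact ⟨hLL, le_rfl⟩
    have hwm : ∀ n, Monotone (w n) := fun n s t hst => by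
      by_cases hs : s < 0
      · have : w n s = D.L₀ := by simp [w, hs]
        rw [this]
        exact (hw n t).1
      by_cases ht : t < T
      · have ht0 : ¬ t < 0 := fun h => hs (hst.trans_lt h)
        have hsT : s < T := hst.trans_lt ht
        simp only [w, hs, ht, ht0, hsT, if_false, if_true]
        exact (hℓ _ n.succ_pos).monotoneOn ⟨not_lt.1 hs, hsT⟩ ⟨not_lt.1 ht0, ht⟩ hst
      · have : w n t = D.L := by
          simp [w, ht, not_lt.2 (hT.le.trans (not_lt.1 ht))]
        rw [this]
        exact (hw n s).2
    obtain ⟨σ, hσ, v, hv⟩ := helly_selection (fun n t => ⟨w n t, hw n t⟩) hwm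
    refine ⟨fun k => σ k + 1, fun a b hab => Nat.succ_lt_succ (hσ hab), fun t => v t,
      fun t ht => ?_⟩
    have h1 := (continuous_subtype_val.tendsto (v t)).comp (hv t)
    refine h1.congr fun k => ?_
    simp [w, not_lt.2 ht.1, ht.2]
  · intro σ hσ ℓlim hlim t ht
    have hσpos : ∀ᶠ k in atTop, 0 < σ k := by
      filter_upwards [eventually_gt_atTop 0] with k hk using hk.trans_le (hσ.id_le k)
    set S : Set ℝ := {l | l ∈ Icc D.L₀ D.L ∧
        gammaLiminf (Icc D.L₀ D.L) (fun k => D.releaseRatio g (σ k)) l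
          < (ENNReal.ofReal (f t ^ 2))⁻¹} with hS
    have hSbdd : BddBelow S := ⟨D.L₀, fun l hl => hl.1.1⟩
    have hmem : ∀ τ ∈ Ioo t T, ℓlim τ ∈ S := by
      intro τ hτ
      have hτ' : τ ∈ Ico 0 T := ⟨ht.1.trans hτ.1.le, hτ.2⟩
      refine ⟨isClosed_Icc.mem_of_tendsto (hlim τ hτ')
        (hσpos.mono fun k hk => (hℓ _ hk).mapsTo hτ'), ?_⟩
      have hft : 0 ≤ f t := by
        rw [← hf0]
        exact hfmono.monotoneOn ⟨le_rfl, hT.le⟩ ⟨ht.1, ht.2.le⟩ ht.1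
      have hlt : f t < f τ := hfmono ⟨ht.1, ht.2.le⟩ ⟨hτ'.1, hτ.2.le⟩ hτ.1
      have hinv : (ENNReal.ofReal (f τ ^ 2))⁻¹ < (ENNReal.ofReal (f t ^ 2))⁻¹ := by
        rw [ENNReal.inv_lt_inv]
        have h1 : f t ^ 2 < f τ ^ 2 := pow_lt_pow_left₀ hlt hft two_ne_zero
        exact (ENNReal.ofReal_lt_ofReal_iff ((sq_nonneg _).trans_lt h1)).2 h1
      refine lt_of_le_of_lt ?_ hinv
      -- The default `D.L` only keeps the sequence in [L₀, L] when `σ k = 0`; it does not affect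
      -- limits.
      let y : ℕ → ℝ := fun k => if 0 < σ k then ℓ (σ k) τ else D.L
      have hy : ∀ k, y k ∈ Icc D.L₀ D.L := fun k => by
        simp only [y]
        split_ifs with hk
        · exact (hℓ _ hk).mapsTo hτ'
        · exact ⟨D.L₀_lt.le, le_rfl⟩
      have hyeq : ∀ᶠ k in atTop, ℓ (σ k) τ = y k := hσpos.mono fun k hk => by simp [y, hk]
      unfold gammaLiminf
      refine iInf_le_of_le y (iInf_le_of_le hy (iInf_le_of_le ((hlim τ hτ').congr' hyeq) ?_))
      refine (liminf_le_liminf (v := fun _ => (ENNReal.ofReal (f τ ^ 2))⁻¹) ?_).trans_eq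
        (liminf_const _)
      filter_upwards [hσpos, hyeq] with k hk hk'
      rw [← hk']
      exact (hℓ _ hk).releaseRatio_le hτ'
    refine tendsto_order.2 ⟨fun c hc => ?_, fun c hc => ?_⟩
    · filter_upwards [Ioo_mem_nhdsGT ht.2] with τ hτ
      exact hc.trans_le (csInf_le hSbdd (hmem τ hτ))
    · have hSne : S.Nonempty := by
        obtain ⟨τ, hτ⟩ := nonempty_Ioo.2 ht.2
        exact ⟨_, hmem τ hτ⟩
      obtain ⟨l, ⟨-, hl⟩, hlc⟩ := exists_lt_of_csInf_lt hSne hc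
      simp only [gammaLiminf, iInf_lt_iff] at hl
      obtain ⟨y, hyS, hy, hlt⟩ := hl
      -- The gap between b and 1/f²(t) leaves room to pass from t to later times τ, by continuity of
      -- f.
      obtain ⟨b, hb1, hb2⟩ := exists_between hlt
      have hfreq := frequently_lt_of_liminf_lt (by isBoundedDefault) hb1
      have hcont : Tendsto (fun τ => (ENNReal.ofReal (f τ ^ 2))⁻¹) (𝓝[>] t)
          (𝓝 (ENNReal.ofReal (f t ^ 2))⁻¹) := by
        have h1 : Tendsto f (𝓝[>] t) (𝓝 (f t)) :=
          (hf.continuousOn t ⟨ht.1, ht.2.le⟩).mono_left <| nhdsWithin_le_of_mem <|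
            mem_of_superset (Ioo_mem_nhdsGT ht.2) fun s hs => ⟨ht.1.trans hs.1.le, hs.2.le⟩
        exact (ENNReal.tendsto_ofReal (h1.pow 2)).inv
      filter_upwards [hcont.eventually (lt_mem_nhds hb2), Ioo_mem_nhdsGT ht.2] with τ h1 hτ
      have hτ' : τ ∈ Ico 0 T := ⟨ht.1.trans hτ.1.le, hτ.2⟩
      refine lt_of_le_of_lt ?_ hlc
      refine le_of_tendsto_of_tendsto_of_frequently (hlim τ hτ') hy ?_
      refine (hfreq.and_eventually hσpos).mono fun k hk => ?_
      exact (hℓ _ hk.2).le_of_releaseRatio_lt hk.2 hfmono.monotoneOn hf0 hτ' (hyS k)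
        (hk.1.trans h1)
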